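/- **Setting.** Fix a second-order language $L$ (function symbols and relation symbols of all finite arities; infinitely many individual variables and, for each $n\ge 0$, infinitely many $n$-ary relation variables), with countably many function symbols, and a set $E$ of equations between individual terms of $L$. *Types* are the formulas built from atoms $X(t_1,\dots,t_n)$ ($X$ a relation variable or relation symbol) with $\to$, $\forall x$ and $\forall X$, up to $\alpha$-equivalence. A *particular case* of an equation $a=b$ is $a\sigma=b\sigma$ or $b\sigma=a\sigma$ with $\sigma$ a simultaneous substitution of terms. $\Lambda$ is the set of untyped $\lambda$-terms (over countably many variables) and $\to_\beta$ is $\beta$-reduction in any number of steps. **The system $\mathcal{AF}2_0$.** $\Gamma\vdash t:A$ is generated by: the axioms $\Gamma\vdash x_i:A_i$ for $x_i:A_i$ in $\Gamma$; the usual introduction and elimination rules for $\to$; from $t:A$ infer $t:\forall xA$, resp. $t:\forall XA$, if $x$, resp. $X$, is not free in $\Gamma$; from $t:\forall xA$ infer $t:A[u/x]$ for any term $u$; from $t:\forall XA$ infer $t:A[Y/X]$ for any relation variable or relation symbol $Y$ of the same arity as $X$; from $t:A[u/x]$ infer $t:A[v/x]$ if $u=v$ is a particular case of an equation of $E$. **Semantics.**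 $G\subseteq\Lambda$ is *saturated* if $u\in G$ and $t\to_\beta u$ imply $t\in G$. For $G,G'\subseteq\Lambda$ put $G\to G'=\{u : (u)t\in G' \text{ for all } t\in G\}$. A set $R$ of saturated sets is *adequate* if it is closed under $\to$ and under arbitrary intersections (so $\Lambda\in R$). A *$\Lambda_\beta$-model* $M$ consists of a non-empty set $|M|$, an adequate $R$, a function $f_M:|M|^n\to|M|$ for each $n$-ary function symbol $f$, and a function $P_M:|M|^n\to R$ for each $n$-ary relation symbol $P$. An interpretation $I$ maps individual variables to $|M|$ and $n$-ary relation variables to functions $|M|^n\to R$. The value $|A|_{M,I}$ is defined by the given functions on atoms, by $|A\to B|_{M,I}=|A|_{M,I}\to|B|_{M,I}$, and for $\forall x$ and $\forall X$ by intersecting over all values in $|M|$ of $x$, resp. over all functions $|M|^n\to R$ for $X$. $M$ satisfies $E$ if the two sides of every equation of $E$ have equal values in $|M|$ for every interpretation. For closed $A$, $|A|_{M,I}$ does not depend on $I$; $|A|_\beta$ is the intersection of these values over all $\Lambda_\beta$-models $M$ satisfying $E$. **Good positive types.** Positive ($\forall^+$) and negative ($\forall^-$) types are defined by: atoms are both;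 $B\to A$ is $\forall^+$ if $B$ is $\forall^-$ and $A$ is $\forall^+$; $B\to A$ is $\forall^-$ if $B$ is $\forall^+$ and $A$ is $\forall^-$ and does not begin with a first-order quantifier; $\forall XA$ is $\forall^+$ if $A$ is $\forall^+$ and $X$ is free in $A$; $\forall xA$ is $\forall^-$ if $A$ is $\forall^-$. On types, $\le$ is the reflexive transitive closure of $\forall xA\mapsto A[u/x]$ ($u$ any term) and $\forall XA\mapsto A[F/X(x_1,\dots,x_n)]$ ($F$ any formula); $A<B$ means $A\le B$ and $A\ne B$; $\sim$ is the reflexive transitive closure of the relation $C[u/x]\sim' C[v/x]$ for $u=v$ a particular case of an equation of $E$. Attach to the quantifier occurrences of $A$ pairwise disjoint infinite sets of variables, containing no free variable of $A$. Subtypes of $A$ with a sign are defined inductively: $A$ is a positive subtype of $A$, and also a negative one if $A$ is atomic; the positive (negative) subtypes of $B\to C$ include the negative (positive) subtypes of $B$ and the positive (negative) subtypes of $C$; the positive (negative) subtypes of $\forall\xi B$ ($\xi$ first- or second-order) include those of $B[\eta/\xi]$, for each $\eta$ in the set attached to this quantifier. A *subtype with substitution* of $A$ is the result of a simultaneous substitution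 of terms for individual variables in a subtype of $A$. A type $A$ is *good positive* ($\mathcal B^+$) if it is $\forall^+$ and satisfies (*): there are no negative subtypes with substitution $B,C$ of $A$, no $n\ge1$ and no types $C_1,\dots,C_n,D,G$ with $$B<G,\qquad G\sim C_n,\qquad C\le C_1\to(C_2\to(\cdots\to(C_n\to D)\cdots)).$$ **Theorem.** Let $A$ be a closed $\mathcal B^+$ type and $t$ a $\lambda$-term. Then $t\in|A|_\beta$ if and only if there is a $\lambda$-term $t'$ with $t\to_\beta t'$ and $\vdash_{\mathcal{AF}2_0}t':A$. -/

import Mathlib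

universe u v w

namespace AF2

open Relation

/-! ### Pure λ-calculus (de Bruijn indices; a dangling index is a free variable) -/

/-- λ-terms up to α-equivalence. -/
inductive Lam : Type
  | var (x : ℕ) : Lam
  | app (t u : Lam) : Lam
  | lam (t : Lam) : Lam

/-- Lifting of a renaming of indices under a binder. -/
def upRen (ρ : ℕ → ℕ) : ℕ → ℕ
  | 0 => 0
  | k + 1 => ρ k + 1

namespace Lam

def ren : Lam → (ℕ → ℕ) → Lam
  | var x, ρ => var (ρ x)
  | app t u, ρ => app (t.ren ρ) (u.ren ρ)
  | lam t, ρ => lam (t.ren (upRen ρ))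

def up (σ : ℕ → Lam) : ℕ → Lam
  | 0 => var 0
  | k + 1 => (σ k).ren Nat.succ

/-- Simultaneous capture-avoiding substitution. -/
def subst : Lam → (ℕ → Lam) → Lam
  | var x, σ => σ x
  | app t u, σ => app (t.subst σ) (u.subst σ)
  | lam t, σ => lam (t.subst (up σ))

def instMap (u : Lam) : ℕ → Lam
  | 0 => u
  | k + 1 => var k

/-- `t[u/x]` where `x` is the variable with index `0`. -/
def inst (t u : Lam) : Lam := t.subst (instMap u)

end Lam

/-- One step of β-reduction. -/
inductive BetaStep : Lam → Lam → Prop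
  | beta (t u : Lam) : BetaStep (.app (.lam t) u) (t.inst u)
  | appL {t t' : Lam} (u : Lam) : BetaStep t t' → BetaStep (.app t u) (.app t' u)
  | appR (t : Lam) {u u' : Lam} : BetaStep u u' → BetaStep (.app t u) (.app t u')
  | lam {t t' : Lam} : BetaStep t t' → BetaStep (.lam t) (.lam t')

/-- β-reduction `t →β t'` in any number of steps. -/
def BetaRed : Lam → Lam → Prop := ReflTransGen BetaStep

/-! ### Second-order formulas over a language

Individual variables, and relation variables of each arity `n`, are de Bruijn indices in `ℕ`
(each arity has its own indices); a dangling index is a free variable. -/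

/-- Formulas (types) of the language `L`, up to α-equivalence. -/
inductive Formula (L : FirstOrder.Language.{u, v}) : Type (max u v)
  /-- `X(t₁,…,tₙ)`, `X` an `n`-ary relation variable -/
  | var (n : ℕ) (X : ℕ) (ts : Fin n → L.Term ℕ) : Formula L
  /-- `P(t₁,…,tₙ)`, `P` an `n`-ary relation symbol -/
  | sym {n : ℕ} (P : L.Relations n) (ts : Fin n → L.Term ℕ) : Formula L
  | imp (A B : Formula L) : Formula L
  /-- quantification over an individual variable -/
  | all₁ (A : Formula L) : Formula L
  /-- quantification over an `n`-ary relation variable -/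
  | all₂ (n : ℕ) (A : Formula L) : Formula L

/-- Extends a family indexed by (arity, index): the new value `b` is at index `0` of arity `n`, the
old values of arity `n` move up by one, the other arities do not change. -/
def consRel {β : ℕ → Type*} (n : ℕ) (b : β n) (f : ∀ m, ℕ → β m) : ∀ m, ℕ → β m :=
  fun m X =>
    if h : m = n then
      match X with
      | 0 => h ▸ b
      | k + 1 => f m k
    else f m X

/-- The index shift of relation variables caused by a binder of arity `n`. -/
def shiftRel (n : ℕ) : ℕ → ℕ → ℕ := fun m X => if m = n then X + 1 else X

/-- Lifting of a renaming of relation variables under a binder of arity `n`. -/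
def upRel (n : ℕ) (θ : ℕ → ℕ → ℕ) : ℕ → ℕ → ℕ :=
  consRel (β := fun _ => ℕ) n 0 (fun m X => shiftRel n m (θ m X))

section
variable {L : FirstOrder.Language.{u, v}}

/-- Lifting of a substitution of individual terms under a binder. -/
def upTerm (σ : ℕ → L.Term ℕ) : ℕ → L.Term ℕ
  | 0 => .var 0
  | k + 1 => (σ k).relabel Nat.succ

/-- Index `0` is replaced by `a`; the other indices move down. -/
def instTerm (a : L.Term ℕ) : ℕ → L.Term ℕ
  | 0 => a
  | k + 1 => .var k

/-- Indices below `n` are replaced by `ts`; the other indices move down by `n`. -/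
def argSubst {n : ℕ} (ts : Fin n → L.Term ℕ) : ℕ → L.Term ℕ :=
  fun k => if h : k < n then ts ⟨k, h⟩ else .var (k - n)

namespace Formula

/-- Renaming of the free individual variables by `ρ` and of the relation variables by `θ`. -/
def ren : Formula L → (ℕ → ℕ) → (ℕ → ℕ → ℕ) → Formula L
  | var n X ts, ρ, θ => var n (θ n X) (fun i => (ts i).relabel ρ)
  | sym P ts, ρ, _ => sym P (fun i => (ts i).relabel ρ)
  | imp A B, ρ, θ => imp (A.ren ρ θ) (B.ren ρ θ)
  | all₁ A, ρ, θ => all₁ (A.ren (upRen ρ) θ)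
  | all₂ n A, ρ, θ => all₂ n (A.ren ρ (upRel n θ))

/-- Simultaneous capture-avoiding substitution of terms for the individual variables. -/
def subst : Formula L → (ℕ → L.Term ℕ) → Formula L
  | var n X ts, σ => var n X (fun i => (ts i).subst σ)
  | sym P ts, σ => sym P (fun i => (ts i).subst σ)
  | imp A B, σ => imp (A.subst σ) (B.subst σ)
  | all₁ A, σ => all₁ (A.subst (upTerm σ))
  | all₂ n A, σ => all₂ n (A.subst σ)

/-- The formula `X(x₁,…,xₙ)`, where `x₁,…,xₙ` are the individual variables `0,…,n-1`. -/
def genVar (n X : ℕ) : Formula L := var n X (fun i => .var i)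

/-- The formula `P(x₁,…,xₙ)`, where `x₁,…,xₙ` are the individual variables `0,…,n-1`. -/
def genSym {n : ℕ} (P : L.Relations n) : Formula L := sym P (fun i => .var i)

/-- Simultaneous substitution of formulas for relation variables. In the formula `Φ n X` substituted
for the `n`-ary variable `X`, the individual indices `0,…,n-1` are the parameters `x₁,…,xₙ` and
`n + k` is the free individual variable `k`: each atom `X(t₁,…,tₙ)` becomes
`(Φ n X)[t₁/x₁,…,tₙ/xₙ]`. -/
def rsubst : Formula L → (ℕ → ℕ → Formula L) → Formula L
  | var n X ts, Φ => (Φ n X).subst (argSubst ts)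
  | sym P ts, _ => sym P ts
  | imp A B, Φ => imp (A.rsubst Φ) (B.rsubst Φ)
  | all₁ A, Φ =>
      all₁ (A.rsubst (fun m X => (Φ m X).ren (fun k => if k < m then k else k + 1) (fun _ Y => Y)))
  | all₂ n A, Φ =>
      all₂ n (A.rsubst (consRel (β := fun _ => Formula L) n (genVar n 0)
        (fun m X => (Φ m X).ren id (shiftRel n))))

/-- `A[a/x]`, where `x` is the individual variable `0` of `A`. -/
def inst₁ (A : Formula L) (a : L.Term ℕ) : Formula L := A.subst (instTerm a)

/-- `A[F/X(x₁,…,xₙ)]`, where `X` is the `n`-ary relation variable `0` of `A` and `x₁,…,xₙ` are the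
individual variables `0,…,n-1` of `F`. -/
def inst₂ (n : ℕ) (A F : Formula L) : Formula L :=
  A.rsubst (consRel (β := fun _ => Formula L) n F genVar)

/-- Weakening by a new individual variable. -/
def shift₁ (A : Formula L) : Formula L := A.ren Nat.succ (fun _ Y => Y)

/-- Weakening by a new `n`-ary relation variable. -/
def shift₂ (n : ℕ) (A : Formula L) : Formula L := A.ren id (shiftRel n)

/-- The individual variable `x` is free in the formula. -/
def HasInd : Formula L → ℕ → Prop
  | var _ _ ts, x => ∃ i, x ∈ (ts i).varFinset
  | sym _ ts, x => ∃ i, x ∈ (ts i).varFinset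
  | imp A B, x => A.HasInd x ∨ B.HasInd x
  | all₁ A, x => A.HasInd (x + 1)
  | all₂ _ A, x => A.HasInd x

/-- The `n`-ary relation variable `X` is free in the formula. -/
def HasRel : Formula L → ℕ → ℕ → Prop
  | var m Y _, n, X => m = n ∧ Y = X
  | sym _ _, _, _ => False
  | imp A B, n, X => A.HasRel n X ∨ B.HasRel n X
  | all₁ A, n, X => A.HasRel n X
  | all₂ m A, n, X => A.HasRel n (shiftRel m n X)

/-- A closed formula. -/
def Closed (A : Formula L) : Prop :=
  (∀ x, ¬ A.HasInd x) ∧ ∀ n X, ¬ A.HasRel n X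

/-- Atomic formulas. -/
def IsAtomic : Formula L → Prop
  | var _ _ _ => True
  | sym _ _ => True
  | _ => False

/-- The formula begins with a first-order quantifier. -/
def StartsAll₁ : Formula L → Prop
  | all₁ _ => True
  | _ => False

end Formula

/-! ### Equations and the typing system -/

/-- `a = b` is a particular case of an equation of `E`; an equation is a pair of terms. -/
def IsCase (E : Set (L.Term ℕ × L.Term ℕ)) (a b : L.Term ℕ) : Prop :=
  ∃ e ∈ E, ∃ σ : ℕ → L.Term ℕ,
    (a = e.1.subst σ ∧ b = e.2.subst σ) ∨ (a = e.2.subst σ ∧ b = e.1.subst σ)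

/-- `Γ ⊢ t : A` in the system `AF2₀` with equations `E`: the second-order quantifier is only
instantiated by relation variables and relation symbols of the right arity. The context `Γ` lists
the types of the λ-variables `0, 1, …`. -/
inductive Typed₀ (E : Set (L.Term ℕ × L.Term ℕ)) : List (Formula L) → Lam → Formula L → Prop
  | ax {Γ : List (Formula L)} {x : ℕ} {A : Formula L} (h : Γ[x]? = some A) : Typed₀ E Γ (.var x) A
  | lam {Γ : List (Formula L)} {t : Lam} {A B : Formula L} (h : Typed₀ E (A :: Γ) t B) :
      Typed₀ E Γ (.lam t) (.imp A B)
  | app {Γ : List (Formula L)} {t s : Lam} {A B : Formula L} (h : Typed₀ E Γ t (.imp A B))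
      (h' : Typed₀ E Γ s A) : Typed₀ E Γ (.app t s) B
  | all₁_intro {Γ : List (Formula L)} {t : Lam} {A : Formula L}
      (h : Typed₀ E (Γ.map Formula.shift₁) t A) : Typed₀ E Γ t (.all₁ A)
  | all₁_elim {Γ : List (Formula L)} {t : Lam} {A : Formula L} (a : L.Term ℕ)
      (h : Typed₀ E Γ t (.all₁ A)) : Typed₀ E Γ t (A.inst₁ a)
  | all₂_intro {Γ : List (Formula L)} {t : Lam} {n : ℕ} {A : Formula L}
      (h : Typed₀ E (Γ.map (Formula.shift₂ n)) t A) : Typed₀ E Γ t (.all₂ n A)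
  | all₂_elim_var {Γ : List (Formula L)} {t : Lam} {n : ℕ} {A : Formula L} (Y : ℕ)
      (h : Typed₀ E Γ t (.all₂ n A)) : Typed₀ E Γ t (A.inst₂ n (.genVar n Y))
  | all₂_elim_sym {Γ : List (Formula L)} {t : Lam} {n : ℕ} {A : Formula L} (P : L.Relations n)
      (h : Typed₀ E Γ t (.all₂ n A)) : Typed₀ E Γ t (A.inst₂ n (.genSym P))
  | eq {Γ : List (Formula L)} {t : Lam} {A : Formula L} {a b : L.Term ℕ} (hab : IsCase E a b)
      (h : Typed₀ E Γ t (A.inst₁ a)) : Typed₀ E Γ t (A.inst₁ b)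

/-! ### The relations `≤`, `<` and `∼` on types -/

/-- One instantiation of a head quantifier, by an arbitrary term or an arbitrary formula. -/
inductive Inst : Formula L → Formula L → Prop
  | first (A : Formula L) (a : L.Term ℕ) : Inst (.all₁ A) (A.inst₁ a)
  | second (n : ℕ) (A F : Formula L) : Inst (.all₂ n A) (A.inst₂ n F)

/-- `A ≤ B` -/
def Le : Formula L → Formula L → Prop := ReflTransGen Inst

/-- `A < B` -/
def Lt (A B : Formula L) : Prop := Le A B ∧ A ≠ B

/-- One replacement along a particular case of an equation. -/
def SimStep (E : Set (L.Term ℕ × L.Term ℕ)) (A B : Formula L) : Prop :=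
  ∃ (C : Formula L) (a b : L.Term ℕ), IsCase E a b ∧ A = C.inst₁ a ∧ B = C.inst₁ b

/-- `A ∼ B` -/
def Sim (E : Set (L.Term ℕ × L.Term ℕ)) : Formula L → Formula L → Prop := ReflTransGen (SimStep E)

/-! ### Positive types, subtypes, good positive types -/

/-- Polarities. -/
inductive Sign : Type
  | pos | neg

def Sign.flip : Sign → Sign
  | pos => neg
  | neg => pos

/-- `Polar .pos A`: `A` is a positive type (`∀⁺`); `Polar .neg A`: `A` is a negative type (`∀⁻`). -/
def Polar : Sign → Formula L → Prop
  | _, .var _ _ _ => True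
  | _, .sym _ _ => True
  | .pos, .imp B A => Polar .neg B ∧ Polar .pos A
  | .neg, .imp B A => Polar .pos B ∧ Polar .neg A ∧ ¬ A.StartsAll₁
  | .pos, .all₁ _ => False
  | .neg, .all₁ A => Polar .neg A
  | .pos, .all₂ n A => Polar .pos A ∧ A.HasRel n 0
  | .neg, .all₂ _ _ => False

/-- Steps of a path from the root of a formula to a subformula. -/
inductive Dir : Type
  | left | right | body

/-- `SubtypeAt nm p s A S`: `S` is a subtype of sign `s` of the formula `A`, which stands at the end
of the (reversed) path `p` in an ambient formula. The variable bound by the quantifier at the path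
`q` is replaced by some variable of the set `{nm q i | i ∈ ℕ}` attached to this quantifier. -/
inductive SubtypeAt (nm : List Dir → ℕ → ℕ) : List Dir → Sign → Formula L → Formula L → Prop
  | self (p : List Dir) (A : Formula L) : SubtypeAt nm p .pos A A
  | atom (p : List Dir) (s : Sign) (A : Formula L) (h : A.IsAtomic) : SubtypeAt nm p s A A
  | impL {p : List Dir} {s : Sign} {B S : Formula L} (C : Formula L)
      (h : SubtypeAt nm (.left :: p) s B S) : SubtypeAt nm p s.flip (.imp B C) S
  | impR {p : List Dir} {s : Sign} {C S : Formula L} (B : Formula L)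
      (h : SubtypeAt nm (.right :: p) s C S) : SubtypeAt nm p s (.imp B C) S
  | all₁ {p : List Dir} {s : Sign} {B S : Formula L} (i : ℕ)
      (h : SubtypeAt nm (.body :: p) s (B.inst₁ (.var (nm p i))) S) : SubtypeAt nm p s (.all₁ B) S
  | all₂ {p : List Dir} {s : Sign} {n : ℕ} {B S : Formula L} (i : ℕ)
      (h : SubtypeAt nm (.body :: p) s (B.inst₂ n (.genVar n (nm p i))) S) :
      SubtypeAt nm p s (.all₂ n B) S

/-- The sets of variables attached to the quantifiers of `A` are infinite, pairwise disjoint, and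
do not contain free variables of `A`. -/
def Admissible (nm : List Dir → ℕ → ℕ) (A : Formula L) : Prop :=
  Function.Injective (Function.uncurry nm) ∧
    ∀ p i, ¬ A.HasInd (nm p i) ∧ ∀ n, ¬ A.HasRel n (nm p i)

/-- `S` is a subtype with substitution of sign `s` of `A`: terms are substituted simultaneously for
individual variables in a subtype of sign `s`. -/
def SubtypeSubst (nm : List Dir → ℕ → ℕ) (s : Sign) (A S : Formula L) : Prop :=
  ∃ (T : Formula L) (σ : ℕ → L.Term ℕ), SubtypeAt nm [] s A T ∧ S = T.subst σ

/-- Condition (*) on a positive type `A`: no two negative subtypes with substitution `B`, `C` of `A`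
satisfy `B < G`, `G ∼ Cₙ` and `C ≤ C₁ → (⋯ → (Cₙ → D))` with `n ≥ 1`; the list `Cs` is
`C₁, …, Cₙ₋₁`. -/
def StarPos (E : Set (L.Term ℕ × L.Term ℕ)) (A : Formula L) : Prop :=
  ∀ nm : List Dir → ℕ → ℕ, Admissible nm A →
    ∀ B C : Formula L, SubtypeSubst nm .neg A B → SubtypeSubst nm .neg A C →
      ∀ (Cs : List (Formula L)) (Cn D G : Formula L),
        ¬ (Lt B G ∧ Sim E G Cn ∧ Le C (Cs.foldr .imp (.imp Cn D)))

/-- `A` is a good positive type (`B⁺`). -/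
def GoodPos (E : Set (L.Term ℕ × L.Term ℕ)) (A : Formula L) : Prop :=
  Polar .pos A ∧ StarPos E A

end

/-! ### `Λβ`-models -/

/-- `→β`-saturated sets of λ-terms. -/
def Saturated (G : Set Lam) : Prop := ∀ t s : Lam, s ∈ G → BetaRed t s → t ∈ G

/-- `G → G'` -/
def Arrow (G G' : Set Lam) : Set Lam := {s | ∀ t ∈ G, Lam.app s t ∈ G'}

/-- Adequate sets of `→β`-saturated sets. -/
def Adequate (R : Set (Set Lam)) : Prop :=
  (∀ G ∈ R, Saturated G) ∧ (∀ G ∈ R, ∀ G' ∈ R, Arrow G G' ∈ R) ∧ ∀ T ⊆ R, ⋂₀ T ∈ R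

/-- `Λβ`-models for the language `L`. -/
structure Model (L : FirstOrder.Language.{u, v}) where
  Base : Type w
  nonempty : Nonempty Base
  R : Set (Set Lam)
  adequate : Adequate R
  func : ∀ {n : ℕ}, L.Functions n → (Fin n → Base) → Base
  rel : ∀ {n : ℕ}, L.Relations n → (Fin n → Base) → R

namespace Model

variable {L : FirstOrder.Language.{u, v}} (M : Model.{u, v, w} L)

/-- Value of a term under an assignment of the individual variables. -/
def val (I : ℕ → M.Base) : L.Term ℕ → M.Base
  | .var x => I x
  | .func f ts => M.func f (fun i => val I (ts i))

/-- The assignment giving `a` to the newly bound variable `0`. -/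
def consInd (a : M.Base) (I : ℕ → M.Base) : ℕ → M.Base
  | 0 => a
  | k + 1 => I k

/-- The value `|A|_{M,I}`, where the interpretation is given by its part `I` on the individual
variables and its part `J` on the relation variables. -/
def value : Formula L → (ℕ → M.Base) → (∀ n, ℕ → (Fin n → M.Base) → M.R) → Set Lam
  | .var n X ts, I, J => J n X (fun i => M.val I (ts i))
  | .sym P ts, I, _ => M.rel P (fun i => M.val I (ts i))
  | .imp A B, I, J => Arrow (value A I J) (value B I J)
  | .all₁ A, I, J => ⋂ a : M.Base, value A (M.consInd a I) J
  | .all₂ n A, I, J => ⋂ Φ : (Fin n → M.Base) → M.R,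
      value A I (consRel (β := fun m => (Fin m → M.Base) → M.R) n Φ J)

/-- `M` satisfies all equations of `E` (universally closed). -/
def Satisfies (E : Set (L.Term ℕ × L.Term ℕ)) : Prop :=
  ∀ e ∈ E, ∀ I : ℕ → M.Base, M.val I e.1 = M.val I e.2

end Model

/-- `|A|_β` for a closed type `A`: the intersection of the values of `A` in all `Λβ`-models of `E`
(the value of a closed type does not depend on the interpretation). -/
def betaValue {L : FirstOrder.Language.{u, v}} (E : Set (L.Term ℕ × L.Term ℕ)) (A : Formula L) : Set Lam :=
  {t | ∀ M : Model.{u, v, max u w} L, M.Satisfies E →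
    ∀ (I : ℕ → M.Base) (J : ∀ n, ℕ → (Fin n → M.Base) → M.R), t ∈ M.value A I J}

end AF2

/-! If `t'` is typed, soundness puts it in every value, and saturation carries membership back along
`t →β t'`.

The converse uses a canonical model. Enumerate all negative subtypes with substitution of `A` in an
infinite context `Γ`, each infinitely often. This is possible because there are only countably many
terms. The individuals are terms modulo interchangeability up to `∼`, `R` consists of all saturated
sets, and an atom is interpreted by the λ-terms that reduce to a normal term of that type: one typed
in `Γ` that is an abstraction, or a variable applied to typed arguments (`Neutral`).

Induction on size then gives two claims at once (`canonical_main`): members of the value of a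
positive subtype reduce to normal terms of that type, and neutral terms of a negative subtype belong
to its value.

The delicate case is a member `t` of a positive `B → C`. Apply `t` to a fresh `y : B`; by induction
`(t)y` reduces to a normal term of type `C`. If the outer redex has been contracted, abstracting `y`
yields a typed reduct of `t` (`BetaRed.abs`). Otherwise the result is `(t₁)y`, where `t₁` is neutral
of some type `B' → C` and `y` received `B'` through `B ≤ G ∼ B'`. Since `λy.(t₁)y` is not a β-reduct
of `t`, the term `t₁` itself must have type `B → C`. Condition (*) excludes `B < G`, so `B ∼ B'` and
`t₁` has the right type.

For a positive `∀X B`, choose for `X` a name absent from the declared types of the variables of `t`.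
A negative `∀x B` is instantiated at the head variable, because the clause on first-order
quantifiers in `∀⁻` keeps them out of the codomains of arrows.

Finally, `A` is a positive subtype of itself, and `Γ` declares no free variable of `t`, so the
typing obtained holds in the empty context. -/

namespace AF2

open Relation

/-! ### λ-terms: free variables, renaming and substitution -/

namespace Lam

/-- The variable `y` is free in the λ-term. -/
def HasVar : Lam → ℕ → Prop
  | var x, y => x = y
  | app t s, y => t.HasVar y ∨ s.HasVar y
  | lam t, y => t.HasVar (y + 1)

theorem exists_bound (t : Lam) : ∃ k, ∀ x, t.HasVar x → x < k := by
  induction t with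
  | var x => exact ⟨x + 1, by rintro y rfl; omega⟩
  | app t s iht ihs =>
    obtain ⟨k, hk⟩ := iht
    obtain ⟨l, hl⟩ := ihs
    refine ⟨max k l, ?_⟩
    rintro x (h | h)
    · exact lt_max_of_lt_left (hk x h)
    · exact lt_max_of_lt_right (hl x h)
  | lam t ih =>
    obtain ⟨k, hk⟩ := ih
    exact ⟨k, fun x h => by have := hk _ h; omega⟩

theorem finite_hasVar (t : Lam) : {x | t.HasVar x}.Finite := by
  obtain ⟨k, hk⟩ := t.exists_bound
  exact (Set.finite_lt_nat k).subset hk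

theorem hasVar_ren {t : Lam} {ρ : ℕ → ℕ} {y : ℕ} (h : (t.ren ρ).HasVar y) :
    ∃ x, t.HasVar x ∧ ρ x = y := by
  induction t generalizing ρ y with
  | var x => exact ⟨x, rfl, h⟩
  | app t s iht ihs =>
    rcases h with h | h
    · obtain ⟨x, hx, e⟩ := iht h
      exact ⟨x, .inl hx, e⟩
    · obtain ⟨x, hx, e⟩ := ihs h
      exact ⟨x, .inr hx, e⟩
  | lam t ih =>
    obtain ⟨x, hx, e⟩ := ih h
    cases x with
    | zero => simp [upRen] at e
    | succ x => exact ⟨x, hx, by simpa [upRen] using e⟩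

theorem HasVar.ren {t : Lam} {x : ℕ} (h : t.HasVar x) (ρ : ℕ → ℕ) : (t.ren ρ).HasVar (ρ x) := by
  induction t generalizing ρ x with
  | var y => exact congrArg ρ h
  | app t s iht ihs => exact h.imp (iht · ρ) (ihs · ρ)
  | lam t ih => exact ih h (upRen ρ)

theorem hasVar_subst {t : Lam} {σ : ℕ → Lam} {y : ℕ} (h : (t.subst σ).HasVar y) :
    ∃ x, t.HasVar x ∧ (σ x).HasVar y := by
  induction t generalizing σ y with
  | var x => exact ⟨x, rfl, h⟩
  | app t s iht ihs =>
    rcases h with h | h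
    · obtain ⟨x, hx, e⟩ := iht h
      exact ⟨x, .inl hx, e⟩
    · obtain ⟨x, hx, e⟩ := ihs h
      exact ⟨x, .inr hx, e⟩
  | lam t ih =>
    obtain ⟨x, hx, e⟩ := ih h
    cases x with
    | zero => simp [up, HasVar] at e
    | succ x =>
      obtain ⟨z, hz, e⟩ := hasVar_ren e
      exact ⟨x, hx, by cases e; exact hz⟩

theorem subst_congr {t : Lam} {σ τ : ℕ → Lam} (h : ∀ x, t.HasVar x → σ x = τ x) :
    t.subst σ = t.subst τ := by
  induction t generalizing σ τ with
  | var x => exact h x rfl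
  | app t s iht ihs =>
    exact congrArg₂ app (iht fun x hx => h x (.inl hx)) (ihs fun x hx => h x (.inr hx))
  | lam t ih =>
    refine congrArg lam (ih fun x hx => ?_)
    cases x with
    | zero => rfl
    | succ x => simp only [up]; rw [h x hx]

theorem ren_eq_subst (t : Lam) (ρ : ℕ → ℕ) : t.ren ρ = t.subst (fun x => var (ρ x)) := by
  induction t generalizing ρ with
  | var x => rfl
  | app t s iht ihs => exact congrArg₂ app (iht ρ) (ihs ρ)
  | lam t ih =>
    refine congrArg lam ((ih _).trans (subst_congr fun x _ => ?_))
    cases x <;> rfl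

theorem ren_subst (t : Lam) (ρ : ℕ → ℕ) (σ : ℕ → Lam) :
    (t.ren ρ).subst σ = t.subst (fun x => σ (ρ x)) := by
  induction t generalizing ρ σ with
  | var x => rfl
  | app t s iht ihs => exact congrArg₂ app (iht ρ σ) (ihs ρ σ)
  | lam t ih =>
    refine congrArg lam ((ih _ _).trans (subst_congr fun x _ => ?_))
    cases x <;> rfl

theorem ren_ren (t : Lam) (ρ θ : ℕ → ℕ) : (t.ren ρ).ren θ = t.ren (fun x => θ (ρ x)) := by
  rw [ren_eq_subst _ θ, ren_subst, ren_eq_subst]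

theorem subst_ren (t : Lam) (σ : ℕ → Lam) (ρ : ℕ → ℕ) :
    (t.subst σ).ren ρ = t.subst (fun x => (σ x).ren ρ) := by
  induction t generalizing ρ σ with
  | var x => rfl
  | app t s iht ihs => exact congrArg₂ app (iht σ ρ) (ihs σ ρ)
  | lam t ih =>
    refine congrArg lam ((ih _ _).trans (subst_congr fun x _ => ?_))
    cases x with
    | zero => rfl
    | succ x => simp only [up, ren_ren]; rfl

theorem subst_subst (t : Lam) (σ τ : ℕ → Lam) :
    (t.subst σ).subst τ = t.subst (fun x => (σ x).subst τ) := by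
  induction t generalizing σ τ with
  | var x => rfl
  | app t s iht ihs => exact congrArg₂ app (iht σ τ) (ihs σ τ)
  | lam t ih =>
    refine congrArg lam ((ih _ _).trans (subst_congr fun x _ => ?_))
    cases x with
    | zero => rfl
    | succ x => simp only [up, ren_subst, subst_ren]

theorem subst_var (t : Lam) : t.subst var = t := by
  induction t with
  | var x => rfl
  | app t s iht ihs => exact congrArg₂ app iht ihs
  | lam t ih =>
    refine congrArg lam (Eq.trans (subst_congr fun x _ => ?_) ih)
    cases x <;> rfl

theorem ren_eq_self {t : Lam} {ρ : ℕ → ℕ} (h : ∀ x, t.HasVar x → ρ x = x) : t.ren ρ = t := by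
  rw [ren_eq_subst]
  exact (subst_congr fun x hx => by rw [h x hx]).trans t.subst_var

theorem inst_ren (t s : Lam) (ρ : ℕ → ℕ) :
    (t.inst s).ren ρ = (t.ren (upRen ρ)).inst (s.ren ρ) := by
  rw [inst, inst, subst_ren, ren_subst]
  congr 1
  funext x
  cases x <;> rfl

theorem subst_up_inst (t s : Lam) (σ : ℕ → Lam) :
    (t.subst (up σ)).inst s = t.subst (fun | 0 => s | k + 1 => σ k) := by
  rw [inst, subst_subst]
  congr 1
  funext x
  cases x with
  | zero => rfl
  | succ x => simp only [up, ren_subst]; exact subst_var _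

end Lam

/-! ### β-reduction, renaming and free variables -/

theorem BetaStep.ren {t s : Lam} (h : BetaStep t s) (ρ : ℕ → ℕ) :
    BetaStep (t.ren ρ) (s.ren ρ) := by
  induction h generalizing ρ with
  | beta t u => rw [Lam.inst_ren]; exact .beta _ _
  | appL u _ ih => exact .appL _ (ih ρ)
  | appR t _ ih => exact .appR _ (ih ρ)
  | lam _ ih => exact .lam (ih _)

theorem BetaStep.hasVar {t s : Lam} (h : BetaStep t s) {y : ℕ} (hy : s.HasVar y) :
    t.HasVar y := by
  induction h generalizing y with
  | beta t u =>
    obtain ⟨x, hx, e⟩ := Lam.hasVar_subst hy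
    cases x with
    | zero => exact .inr e
    | succ x => cases e; exact .inl hx
  | appL u _ ih => exact hy.imp ih id
  | appR t _ ih => exact hy.imp id ih
  | lam _ ih => exact ih (y := y + 1) hy

theorem BetaRed.ren {t s : Lam} (h : BetaRed t s) (ρ : ℕ → ℕ) :
    BetaRed (t.ren ρ) (s.ren ρ) := by
  induction h with
  | refl => exact .refl
  | tail _ h ih => exact ih.tail (h.ren ρ)

theorem BetaRed.hasVar {t s : Lam} (h : BetaRed t s) {y : ℕ} (hy : s.HasVar y) :
    t.HasVar y := by
  induction h with
  | refl => exact hy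
  | tail _ h ih => exact ih (h.hasVar hy)

theorem BetaRed.appL {t t' : Lam} (h : BetaRed t t') (u : Lam) :
    BetaRed (.app t u) (.app t' u) := by
  induction h with
  | refl => exact .refl
  | tail _ h ih => exact ih.tail (.appL u h)

theorem BetaRed.appR (t : Lam) {u u' : Lam} (h : BetaRed u u') :
    BetaRed (.app t u) (.app t u') := by
  induction h with
  | refl => exact .refl
  | tail _ h ih => exact ih.tail (.appR t h)

theorem BetaRed.lam {t t' : Lam} (h : BetaRed t t') : BetaRed (.lam t) (.lam t') := by
  induction h with
  | refl => exact .refl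
  | tail _ h ih => exact ih.tail (.lam h)

/-- A variable has no reducts, so all steps happen in the function part until, possibly, that part
becomes an abstraction and the outer redex is contracted. -/
theorem BetaRed.app_var {t s : Lam} {y : ℕ} (h : BetaRed (.app t (.var y)) s) :
    (∃ t₁, s = .app t₁ (.var y) ∧ BetaRed t t₁) ∨
      ∃ t₀, BetaRed t (.lam t₀) ∧ BetaRed (t₀.inst (.var y)) s := by
  induction h with
  | refl => exact .inl ⟨t, rfl, .refl⟩
  | tail _ h ih =>
    rcases ih with ⟨t₁, rfl, h₁⟩ | ⟨t₀, h₁, h₂⟩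
    · cases h with
      | beta t₀ => exact .inr ⟨t₀, h₁, .refl⟩
      | appL _ h => exact .inl ⟨_, rfl, h₁.tail h⟩
      | appR _ h => cases h
    · exact .inr ⟨t₀, h₁, h₂.tail h⟩

/-- The renaming that binds the variable `y`. -/
def absRen (y : ℕ) : ℕ → ℕ := fun x => if x = y then 0 else x + 1

/-- Abstracting a fresh variable after applying to it gives back a reduct. -/
theorem BetaRed.abs {t₀ s : Lam} {y : ℕ} (hy : ¬ (Lam.lam t₀).HasVar y)
    (h : BetaRed (t₀.inst (.var y)) s) : BetaRed (.lam t₀) (.lam (s.ren (absRen y))) := by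
  have e : (t₀.inst (.var y)).ren (absRen y) = t₀ := by
    rw [Lam.inst, Lam.subst_ren]
    refine (Lam.subst_congr fun x hx => ?_).trans t₀.subst_var
    cases x with
    | zero => simp [Lam.instMap, Lam.ren, absRen]
    | succ x =>
      have : x ≠ y := by rintro rfl; exact hy hx
      simp [Lam.instMap, Lam.ren, absRen, this]
  have := h.ren (absRen y)
  rw [e] at this
  exact this.lam

/-! ### Terms of the language -/

section
variable {L : FirstOrder.Language.{u, v}}

open FirstOrder Language

theorem term_subst_congr {t : L.Term ℕ} {σ τ : ℕ → L.Term ℕ}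
    (h : ∀ x ∈ t.varFinset, σ x = τ x) : t.subst σ = t.subst τ := by
  induction t with
  | var x => exact h x (by simp [Term.varFinset])
  | func f ts ih =>
    refine congrArg (Term.func f) (funext fun i => ih i fun x hx => h x ?_)
    simp only [Term.varFinset, Finset.mem_biUnion, Finset.mem_univ, true_and]
    exact ⟨i, hx⟩

theorem term_subst_subst (t : L.Term ℕ) (σ τ : ℕ → L.Term ℕ) :
    (t.subst σ).subst τ = t.subst (fun x => (σ x).subst τ) := by
  induction t with
  | var x => rfl
  | func f ts ih => exact congrArg (Term.func f) (funext ih)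

theorem term_subst_var (t : L.Term ℕ) : t.subst Term.var = t := by
  induction t with
  | var x => rfl
  | func f ts ih => exact congrArg (Term.func f) (funext ih)

theorem term_relabel_eq_subst (t : L.Term ℕ) (ρ : ℕ → ℕ) :
    t.relabel ρ = t.subst (fun x => .var (ρ x)) := by
  induction t with
  | var x => rfl
  | func f ts ih => exact congrArg (Term.func f) (funext ih)

theorem mem_varFinset_subst {t : L.Term ℕ} {σ : ℕ → L.Term ℕ} {y : ℕ}
    (h : y ∈ (t.subst σ).varFinset) : ∃ x ∈ t.varFinset, y ∈ (σ x).varFinset := by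
  induction t with
  | var x => exact ⟨x, by simp [Term.varFinset], h⟩
  | func f ts ih =>
    simp only [Term.subst, Term.varFinset, Finset.mem_biUnion, Finset.mem_univ, true_and] at h
    obtain ⟨i, hi⟩ := h
    obtain ⟨x, hx, hy⟩ := ih i hi
    refine ⟨x, ?_, hy⟩
    simp only [Term.varFinset, Finset.mem_biUnion, Finset.mem_univ, true_and]
    exact ⟨i, hx⟩

theorem upTerm_subst (σ τ : ℕ → L.Term ℕ) (x : ℕ) :
    (upTerm σ x).subst (upTerm τ) = upTerm (fun x => (σ x).subst τ) x := by
  cases x with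
  | zero => rfl
  | succ x =>
    simp only [upTerm, term_relabel_eq_subst, term_subst_subst]
    exact congrArg (Term.subst (σ x)) (funext fun k => term_relabel_eq_subst _ _)

theorem upTerm_subst_instTerm (σ : ℕ → L.Term ℕ) (a : L.Term ℕ) (x : ℕ) :
    (upTerm σ (x + 1)).subst (instTerm a) = σ x := by
  simp only [upTerm, term_relabel_eq_subst, term_subst_subst]
  exact term_subst_var _

theorem upTerm_var (ρ : ℕ → ℕ) (x : ℕ) :
    upTerm (L := L) (fun x => .var (ρ x)) x = .var (upRen ρ x) := by
  cases x <;> rfl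

theorem argSubst_fin {n : ℕ} (ts : Fin n → L.Term ℕ) (i : Fin n) :
    argSubst ts i = ts i := by simp [argSubst]

/-! ### Renamings of relation variables -/

theorem consRel_self_zero {β : ℕ → Type*} (n : ℕ) (b : β n) (f : ∀ m, ℕ → β m) :
    consRel n b f n 0 = b := by simp [consRel]

theorem consRel_self_succ {β : ℕ → Type*} (n : ℕ) (b : β n) (f : ∀ m, ℕ → β m) (k : ℕ) :
    consRel n b f n (k + 1) = f n k := by simp [consRel]

theorem consRel_ne {β : ℕ → Type*} {n m : ℕ} (b : β n) (f : ∀ m, ℕ → β m) (k : ℕ) (h : m ≠ n) :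
    consRel n b f m k = f m k := by simp [consRel, h]

theorem shiftRel_self (n k : ℕ) : shiftRel n n k = k + 1 := by simp [shiftRel]

theorem shiftRel_ne {n m : ℕ} (k : ℕ) (h : m ≠ n) : shiftRel n m k = k := by simp [shiftRel, h]

theorem upRel_self_zero (n : ℕ) (θ : ℕ → ℕ → ℕ) : upRel n θ n 0 = 0 := consRel_self_zero ..

theorem upRel_self_succ (n : ℕ) (θ : ℕ → ℕ → ℕ) (k : ℕ) : upRel n θ n (k + 1) = θ n k + 1 := by
  rw [upRel, consRel_self_succ, shiftRel_self]

theorem upRel_ne {n m : ℕ} (θ : ℕ → ℕ → ℕ) (k : ℕ) (h : m ≠ n) : upRel n θ m k = θ m k := by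
  rw [upRel, consRel_ne _ _ _ h, shiftRel_ne _ h]

theorem consRel_shiftRel {β : ℕ → Type*} (n : ℕ) (b : β n) (f : ∀ m, ℕ → β m) (m k : ℕ) :
    consRel n b f m (shiftRel n m k) = f m k := by
  rcases eq_or_ne m n with rfl | h
  · rw [shiftRel_self, consRel_self_succ]
  · rw [shiftRel_ne _ h, consRel_ne _ _ _ h]

theorem upRel_shiftRel (n : ℕ) (θ : ℕ → ℕ → ℕ) (m k : ℕ) :
    upRel n θ m (shiftRel n m k) = shiftRel n m (θ m k) := by
  rw [upRel, consRel_shiftRel]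

/-- Case analysis on a variable below a binder of arity `n`. -/
theorem rel_cases {p : ℕ → ℕ → Prop} (n : ℕ) (h0 : p n 0) (hs : ∀ m k, p m (shiftRel n m k)) :
    ∀ m k, p m k := by
  intro m k
  rcases eq_or_ne m n with rfl | h
  · cases k with
    | zero => exact h0
    | succ k => have := hs m k; rwa [shiftRel_self] at this
  · have := hs m k
    rwa [shiftRel_ne _ h] at this

theorem upRel_upRel (n : ℕ) (θ η : ℕ → ℕ → ℕ) :
    ∀ m k, upRel n η m (upRel n θ m k) = upRel n (fun m X => η m (θ m X)) m k := by
  refine rel_cases n ?_ fun m k => ?_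
  · simp only [upRel_self_zero]
  · simp only [upRel_shiftRel]

theorem upRel_id (n : ℕ) : upRel n (fun _ X => X) = fun _ X => X := by
  funext m k
  revert m k
  refine rel_cases n ?_ fun m k => ?_
  · exact upRel_self_zero ..
  · exact upRel_shiftRel ..

/-- The renaming that sends the `n`-ary variable `0` to `Y`; the other indices move down. -/
def instRel (n Y : ℕ) : ℕ → ℕ → ℕ := consRel (β := fun _ => ℕ) n Y (fun _ X => X)

theorem upRen_id : upRen id = id := by funext x; cases x <;> rfl

/-! ### Renaming and substitution in formulas -/

namespace Formula

/-- Renaming of relation variables. -/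
abbrev rren (A : Formula L) (θ : ℕ → ℕ → ℕ) : Formula L := A.ren id θ

@[simp] theorem rren_var (n X : ℕ) (ts : Fin n → L.Term ℕ) (θ : ℕ → ℕ → ℕ) :
    (var n X ts).rren θ = var n (θ n X) ts := by simp [rren, ren]

@[simp] theorem rren_sym {n : ℕ} (P : L.Relations n) (ts : Fin n → L.Term ℕ) (θ : ℕ → ℕ → ℕ) :
    (sym P ts).rren θ = sym P ts := by simp [rren, ren]

@[simp] theorem rren_imp (A B : Formula L) (θ : ℕ → ℕ → ℕ) :
    (imp A B).rren θ = imp (A.rren θ) (B.rren θ) := rfl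

@[simp] theorem rren_all₁ (A : Formula L) (θ : ℕ → ℕ → ℕ) :
    (all₁ A).rren θ = all₁ (A.rren θ) := by simp [rren, ren, upRen_id]

@[simp] theorem rren_all₂ (n : ℕ) (A : Formula L) (θ : ℕ → ℕ → ℕ) :
    (all₂ n A).rren θ = all₂ n (A.rren (upRel n θ)) := rfl

theorem subst_congr {A : Formula L} {σ τ : ℕ → L.Term ℕ} (h : ∀ x, A.HasInd x → σ x = τ x) :
    A.subst σ = A.subst τ := by
  induction A generalizing σ τ with
  | var n X ts =>
    exact congrArg (var n X) (funext fun i => term_subst_congr fun x hx => h x ⟨i, hx⟩)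
  | sym P ts =>
    exact congrArg (sym P) (funext fun i => term_subst_congr fun x hx => h x ⟨i, hx⟩)
  | imp A B ihA ihB =>
    exact congrArg₂ imp (ihA fun x hx => h x (.inl hx)) (ihB fun x hx => h x (.inr hx))
  | all₁ A ih =>
    refine congrArg all₁ (ih fun x hx => ?_)
    cases x with
    | zero => rfl
    | succ x => simp only [upTerm]; rw [h x hx]
  | all₂ n A ih => exact congrArg (all₂ n) (ih h)

theorem subst_subst (A : Formula L) (σ τ : ℕ → L.Term ℕ) :
    (A.subst σ).subst τ = A.subst (fun x => (σ x).subst τ) := by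
  induction A generalizing σ τ with
  | var n X ts => exact congrArg (var n X) (funext fun i => term_subst_subst _ _ _)
  | sym P ts => exact congrArg (sym P) (funext fun i => term_subst_subst _ _ _)
  | imp A B ihA ihB => exact congrArg₂ imp (ihA _ _) (ihB _ _)
  | all₁ A ih =>
    exact congrArg all₁ ((ih _ _).trans (subst_congr fun x _ => upTerm_subst σ τ x))
  | all₂ n A ih => exact congrArg (all₂ n) (ih _ _)

theorem subst_var (A : Formula L) : A.subst Language.Term.var = A := by
  induction A with
  | var n X ts => exact congrArg (var n X) (funext fun i => term_subst_var _)
  | sym P ts => exact congrArg (sym P) (funext fun i => term_subst_var _)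
  | imp A B ihA ihB => exact congrArg₂ imp ihA ihB
  | all₁ A ih =>
    exact congrArg all₁ ((subst_congr fun x _ => by cases x <;> rfl).trans ih)
  | all₂ n A ih => exact congrArg (all₂ n) ih

/-- Splits a mixed renaming into a term substitution and a renaming of relation variables. The two
commute and can be studied separately. -/
theorem ren_eq (A : Formula L) (ρ : ℕ → ℕ) (θ : ℕ → ℕ → ℕ) :
    A.ren ρ θ = (A.subst (fun x => .var (ρ x))).rren θ := by
  induction A generalizing ρ θ with
  | var n X ts => simp [ren, subst, term_relabel_eq_subst]
  | sym P ts => simp [ren, subst, term_relabel_eq_subst]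
  | imp A B ihA ihB => simp only [ren, subst, rren_imp, ihA, ihB]
  | all₁ A ih =>
    simp only [ren, subst, rren_all₁, ih]
    exact congrArg (fun B => all₁ (rren B θ)) (subst_congr fun x _ => (upTerm_var ρ x).symm)
  | all₂ n A ih => simp only [ren, subst, rren_all₂, ih]

theorem rren_subst (A : Formula L) (θ : ℕ → ℕ → ℕ) (σ : ℕ → L.Term ℕ) :
    (A.rren θ).subst σ = (A.subst σ).rren θ := by
  induction A generalizing θ σ with
  | var n X ts => simp [subst]
  | sym P ts => simp [subst]
  | imp A B ihA ihB => simp only [subst, rren_imp, ihA, ihB]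
  | all₁ A ih => simp only [subst, rren_all₁, ih]
  | all₂ n A ih => simp only [subst, rren_all₂, ih]

theorem rren_congr {A : Formula L} {θ η : ℕ → ℕ → ℕ} (h : ∀ n X, A.HasRel n X → θ n X = η n X) :
    A.rren θ = A.rren η := by
  induction A generalizing θ η with
  | var n X ts => rw [rren_var, rren_var, h n X ⟨rfl, rfl⟩]
  | sym P ts => simp
  | imp A B ihA ihB =>
    exact congrArg₂ imp (ihA fun n X hx => h n X (.inl hx)) (ihB fun n X hx => h n X (.inr hx))
  | all₁ A ih => rw [rren_all₁, rren_all₁, ih h]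
  | all₂ n A ih =>
    refine congrArg (all₂ n) (ih (rel_cases n ?_ fun m k hk => ?_))
    · intro _; rw [upRel_self_zero, upRel_self_zero]
    · rw [upRel_shiftRel, upRel_shiftRel, h m k hk]

theorem rren_rren (A : Formula L) (θ η : ℕ → ℕ → ℕ) :
    (A.rren θ).rren η = A.rren (fun m X => η m (θ m X)) := by
  induction A generalizing θ η with
  | var n X ts => simp
  | sym P ts => simp
  | imp A B ihA ihB => simp only [rren_imp, ihA, ihB]
  | all₁ A ih => simp only [rren_all₁, ih]
  | all₂ n A ih =>
    simp only [rren_all₂, ih]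
    exact congrArg (all₂ n) (rren_congr fun m k _ => upRel_upRel n θ η m k)

theorem rren_id (A : Formula L) : A.rren (fun _ X => X) = A := by
  induction A with
  | var n X ts => simp
  | sym P ts => simp
  | imp A B ihA ihB => simp only [rren_imp, ihA, ihB]
  | all₁ A ih => simp only [rren_all₁, ih]
  | all₂ n A ih => simp only [rren_all₂, upRel_id, ih]

theorem rren_eq_self {A : Formula L} {θ : ℕ → ℕ → ℕ} (h : ∀ n X, A.HasRel n X → θ n X = X) :
    A.rren θ = A := (rren_congr h).trans A.rren_id

theorem ren_ren (A : Formula L) (ρ ρ' : ℕ → ℕ) (θ θ' : ℕ → ℕ → ℕ) :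
    (A.ren ρ θ).ren ρ' θ' = A.ren (fun x => ρ' (ρ x)) (fun m X => θ' m (θ m X)) := by
  rw [ren_eq _ ρ', ren_eq _ ρ, ren_eq, rren_subst, subst_subst, rren_rren]
  rfl

theorem shift₁_eq (A : Formula L) : A.shift₁ = A.subst (fun x => .var (x + 1)) := by
  rw [shift₁, ren_eq, rren_id]

theorem rren_shift₁ (A : Formula L) (θ : ℕ → ℕ → ℕ) : (A.rren θ).shift₁ = A.shift₁.rren θ := by
  rw [shift₁_eq, shift₁_eq, rren_subst]

theorem shift₁_inst₁ (A : Formula L) (a : L.Term ℕ) : A.shift₁.inst₁ a = A := by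
  rw [shift₁_eq, inst₁, subst_subst]
  exact A.subst_var

theorem inst₁_rren (A : Formula L) (a : L.Term ℕ) (θ : ℕ → ℕ → ℕ) :
    (A.inst₁ a).rren θ = (A.rren θ).inst₁ a := (rren_subst _ _ _).symm

theorem subst_upTerm_inst₁ (A : Formula L) (σ : ℕ → L.Term ℕ) (a : L.Term ℕ) :
    (A.subst (upTerm σ)).inst₁ a = A.subst (fun | 0 => a | k + 1 => σ k) := by
  rw [inst₁, subst_subst]
  refine subst_congr fun x _ => ?_
  cases x with
  | zero => rfl
  | succ x => exact upTerm_subst_instTerm σ a x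

theorem rsubst_congr {A : Formula L} {Φ Ψ : ℕ → ℕ → Formula L} (h : ∀ n X, Φ n X = Ψ n X) :
    A.rsubst Φ = A.rsubst Ψ := by
  rw [show Φ = Ψ from funext fun n => funext (h n)]

theorem genVar_rren (n X : ℕ) (θ : ℕ → ℕ → ℕ) :
    (genVar n X : Formula L).rren θ = genVar n (θ n X) := rren_var ..

theorem rsubst_genVar (A : Formula L) (θ : ℕ → ℕ → ℕ) :
    A.rsubst (fun n X => genVar n (θ n X)) = A.rren θ := by
  induction A generalizing θ with
  | var n X ts =>
    simp only [rsubst, genVar, subst, rren_var]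
    exact congrArg (var n _) (funext fun i => argSubst_fin ts i)
  | sym P ts => simp [rsubst]
  | imp A B ihA ihB => simp only [rsubst, rren_imp, ihA, ihB]
  | all₁ A ih =>
    simp only [rsubst, rren_all₁, ← ih]
    refine congrArg all₁ (rsubst_congr fun m X => ?_)
    simp [genVar, ren]
  | all₂ n A ih =>
    simp only [rsubst, rren_all₂, ← ih]
    refine congrArg (all₂ n) (rsubst_congr (rel_cases n ?_ fun m X => ?_))
    · rw [consRel_self_zero, upRel_self_zero]
    · rw [consRel_shiftRel, upRel_shiftRel]
      exact genVar_rren _ _ _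

/-- Instances of `∀X` by variables thereby become renamings, which compose easily; the full
machinery of `rsubst` is avoided in most arguments. -/
theorem inst₂_genVar (n : ℕ) (A : Formula L) (Y : ℕ) :
    A.inst₂ n (genVar n Y) = A.rren (instRel n Y) := by
  rw [inst₂, ← rsubst_genVar]
  refine rsubst_congr (rel_cases n ?_ fun m X => ?_)
  · rw [consRel_self_zero, instRel, consRel_self_zero]
  · rw [consRel_shiftRel, instRel, consRel_shiftRel]

theorem rsubst_rren (A : Formula L) (Φ Ψ : ℕ → ℕ → Formula L) (θ η : ℕ → ℕ → ℕ)
    (h : ∀ m X, (Φ m X).rren θ = Ψ m (η m X)) :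
    (A.rsubst Φ).rren θ = (A.rren η).rsubst Ψ := by
  induction A generalizing Φ Ψ θ η with
  | var n X ts => rw [rsubst, ← rren_subst, h, rren_var, rsubst]
  | sym P ts => simp [rsubst]
  | imp A B ihA ihB => simp only [rsubst, rren_imp, ihA _ _ _ _ h, ihB _ _ _ _ h]
  | all₁ A ih =>
    simp only [rsubst, rren_all₁]
    refine congrArg all₁ (ih _ _ _ _ fun m X => ?_)
    rw [← h, ren_ren]
    exact ren_ren ..
  | all₂ n A ih =>
    simp only [rsubst, rren_all₂]
    refine congrArg (all₂ n) (ih _ _ _ _ (rel_cases n ?_ fun m X => ?_))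
    · rw [consRel_self_zero, upRel_self_zero, consRel_self_zero, genVar_rren, upRel_self_zero]
    · rw [consRel_shiftRel, upRel_shiftRel, consRel_shiftRel, ← h, ren_ren]
      refine (ren_ren ..).trans ?_
      congr 1
      funext m X
      exact upRel_shiftRel ..

theorem inst₂_genSym_rren (n : ℕ) (A : Formula L) (P : L.Relations n) (θ : ℕ → ℕ → ℕ) :
    (A.inst₂ n (genSym P)).rren θ = (A.rren (upRel n θ)).inst₂ n (genSym P) := by
  refine rsubst_rren _ _ _ _ _ (rel_cases n ?_ fun m X => ?_)
  · rw [consRel_self_zero, upRel_self_zero, consRel_self_zero]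
    exact rren_sym ..
  · rw [consRel_shiftRel, upRel_shiftRel, consRel_shiftRel, genVar_rren]

theorem rren_instRel_rren (n : ℕ) (A : Formula L) (Y : ℕ) (θ : ℕ → ℕ → ℕ) :
    (A.rren (instRel n Y)).rren θ = (A.rren (upRel n θ)).rren (instRel n (θ n Y)) := by
  rw [rren_rren, rren_rren]
  refine congrArg (rren A) (funext fun m => funext fun X => ?_)
  revert m X
  refine rel_cases n ?_ fun m X => ?_
  · rw [upRel_self_zero, instRel, instRel, consRel_self_zero, consRel_self_zero]
  · rw [upRel_shiftRel, instRel, instRel, consRel_shiftRel, consRel_shiftRel]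

theorem rren_shift₂ (n : ℕ) (A : Formula L) (θ : ℕ → ℕ → ℕ) :
    (A.rren θ).shift₂ n = (A.shift₂ n).rren (upRel n θ) := by
  change (A.rren θ).rren _ = (A.rren _).rren _
  rw [rren_rren, rren_rren]
  exact rren_congr fun m X _ => (upRel_shiftRel ..).symm

/-! ### Free variables of formulas -/

theorem hasRel_subst {A : Formula L} {σ : ℕ → L.Term ℕ} {n X : ℕ} :
    (A.subst σ).HasRel n X ↔ A.HasRel n X := by
  induction A generalizing σ X with
  | var m Y ts => rfl
  | sym P ts => rfl
  | imp A B ihA ihB => exact or_congr ihA ihB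
  | all₁ A ih => exact ih
  | all₂ m A ih => exact ih

theorem hasRel_rren {A : Formula L} {θ : ℕ → ℕ → ℕ} {n Y : ℕ} :
    (A.rren θ).HasRel n Y ↔ ∃ X, A.HasRel n X ∧ θ n X = Y := by
  induction A generalizing θ Y with
  | var m X ts =>
    rw [rren_var]
    constructor
    · rintro ⟨rfl, h⟩
      exact ⟨X, ⟨rfl, rfl⟩, h⟩
    · rintro ⟨_, ⟨rfl, rfl⟩, h⟩
      exact ⟨rfl, h⟩
  | sym P ts => simp [HasRel]
  | imp A B ihA ihB =>
    simp only [rren_imp, HasRel, ihA, ihB, or_and_right, exists_or]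
  | all₁ A ih => rw [rren_all₁]; exact ih
  | all₂ m A ih =>
    simp only [rren_all₂, HasRel, ih]
    constructor
    · rintro ⟨X, hX, e⟩
      rcases eq_or_ne n m with rfl | h
      · cases X with
        | zero => rw [upRel_self_zero, shiftRel_self] at e; omega
        | succ X =>
          refine ⟨X, by rwa [shiftRel_self], ?_⟩
          rw [upRel_self_succ, shiftRel_self] at e
          omega
      · rw [upRel_ne _ _ h, shiftRel_ne _ h] at e
        exact ⟨X, by rwa [shiftRel_ne _ h], e⟩
    · rintro ⟨X, hX, rfl⟩
      exact ⟨_, hX, upRel_shiftRel ..⟩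

theorem hasInd_rren {A : Formula L} {θ : ℕ → ℕ → ℕ} {x : ℕ} :
    (A.rren θ).HasInd x ↔ A.HasInd x := by
  induction A generalizing θ x with
  | var m X ts => rw [rren_var]; rfl
  | sym P ts => rw [rren_sym]
  | imp A B ihA ihB => exact or_congr ihA ihB
  | all₁ A ih => rw [rren_all₁]; exact ih
  | all₂ m A ih => exact ih

theorem hasInd_subst {A : Formula L} {σ : ℕ → L.Term ℕ} {y : ℕ} (h : (A.subst σ).HasInd y) :
    ∃ x, A.HasInd x ∧ y ∈ (σ x).varFinset := by
  induction A generalizing σ y with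
  | var m X ts =>
    obtain ⟨i, hi⟩ := h
    obtain ⟨x, hx, hy⟩ := mem_varFinset_subst hi
    exact ⟨x, ⟨i, hx⟩, hy⟩
  | sym P ts =>
    obtain ⟨i, hi⟩ := h
    obtain ⟨x, hx, hy⟩ := mem_varFinset_subst hi
    exact ⟨x, ⟨i, hx⟩, hy⟩
  | imp A B ihA ihB =>
    rcases h with h | h
    · obtain ⟨x, hx, hy⟩ := ihA h
      exact ⟨x, .inl hx, hy⟩
    · obtain ⟨x, hx, hy⟩ := ihB h
      exact ⟨x, .inr hx, hy⟩
  | all₁ A ih =>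
    obtain ⟨x, hx, hy⟩ := ih h
    cases x with
    | zero => simp [upTerm, Term.varFinset] at hy
    | succ x =>
      refine ⟨x, hx, ?_⟩
      rw [upTerm, term_relabel_eq_subst] at hy
      obtain ⟨z, hz, e⟩ := mem_varFinset_subst hy
      simp only [Term.varFinset, Finset.mem_singleton, Nat.succ_eq_add_one, add_left_inj] at e
      rwa [e]
  | all₂ m A ih => exact ih h

theorem hasInd_inst₁_var {A : Formula L} {z y : ℕ} (h : (A.inst₁ (.var z)).HasInd y) :
    y = z ∨ (all₁ A).HasInd y := by
  obtain ⟨x, hx, hy⟩ := hasInd_subst h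
  cases x with
  | zero => exact .inl (by simpa [instTerm, Term.varFinset] using hy)
  | succ x =>
    refine .inr ?_
    simp only [instTerm, Term.varFinset, Finset.mem_singleton] at hy
    rwa [hy]

theorem hasRel_rren_instRel {n : ℕ} {A : Formula L} {Z m Y : ℕ}
    (h : (A.rren (instRel n Z)).HasRel m Y) : (m = n ∧ Y = Z) ∨ (all₂ n A).HasRel m Y := by
  obtain ⟨X, hX, e⟩ := hasRel_rren.1 h
  clear h
  revert hX e
  refine rel_cases (p := fun m X => A.HasRel m X → instRel n Z m X = Y →
    (m = n ∧ Y = Z) ∨ (all₂ n A).HasRel m Y)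
    n ?_ (fun m X => ?_) m X
  · intro _ e
    rw [instRel, consRel_self_zero] at e
    exact .inl ⟨rfl, e.symm⟩
  · intro hX e
    rw [instRel, consRel_shiftRel] at e
    cases e
    exact .inr hX

/-- Only finitely many relation variables are free in a formula. -/
theorem exists_rel_bound (A : Formula L) : ∃ k, ∀ n X, A.HasRel n X → X < k := by
  induction A with
  | var m Y ts => exact ⟨Y + 1, by rintro n X ⟨rfl, rfl⟩; omega⟩
  | sym P ts => exact ⟨0, by rintro n X ⟨⟩⟩
  | imp A B ihA ihB =>
    obtain ⟨k, hk⟩ := ihA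
    obtain ⟨l, hl⟩ := ihB
    refine ⟨max k l, ?_⟩
    rintro n X (h | h)
    · exact lt_max_of_lt_left (hk n X h)
    · exact lt_max_of_lt_right (hl n X h)
  | all₁ A ih => exact ih
  | all₂ m A ih =>
    obtain ⟨k, hk⟩ := ih
    refine ⟨k, fun n X h => lt_of_le_of_lt ?_ (hk n _ h)⟩
    unfold shiftRel
    split_ifs <;> omega

/-- Number of connectives. -/
def size : Formula L → ℕ
  | var _ _ _ => 0
  | sym _ _ => 0
  | imp A B => A.size + B.size + 1
  | all₁ A => A.size + 1
  | all₂ _ A => A.size + 1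

/-- An instance of a quantified body is not a structural subformula, so later inductions run on
`size`, which term substitutions and relation renamings preserve. -/
theorem size_subst (A : Formula L) (σ : ℕ → L.Term ℕ) : (A.subst σ).size = A.size := by
  induction A generalizing σ with
  | var | sym => rfl
  | imp A B ihA ihB => simp only [subst, size, ihA, ihB]
  | all₁ A ih => simp only [subst, size, ih]
  | all₂ n A ih => simp only [subst, size, ih]

theorem size_rren (A : Formula L) (θ : ℕ → ℕ → ℕ) : (A.rren θ).size = A.size := by
  induction A generalizing θ with
  | var | sym => rfl
  | imp A B ihA ihB => simp only [rren_imp, size, ihA, ihB]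
  | all₁ A ih => simp only [rren_all₁, size, ih]
  | all₂ n A ih => simp only [rren_all₂, size, ih]

end Formula

end

section
variable {L : FirstOrder.Language.{u, v}}

/-! ### Values in a model and soundness -/

namespace Model

variable (M : Model.{u, v, w} L)

theorem val_subst (I : ℕ → M.Base) (t : L.Term ℕ) (σ : ℕ → L.Term ℕ) :
    M.val I (t.subst σ) = M.val (fun x => M.val I (σ x)) t := by
  induction t with
  | var x => rfl
  | func f ts ih => exact congrArg (M.func f) (funext ih)

theorem value_mem (A : Formula L) (I : ℕ → M.Base) (J : ∀ n, ℕ → (Fin n → M.Base) → M.R) :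
    M.value A I J ∈ M.R := by
  induction A generalizing I J with
  | var n X ts => exact (J n X _).2
  | sym P ts => exact (M.rel P _).2
  | imp A B ihA ihB => exact M.adequate.2.1 _ (ihA I J) _ (ihB I J)
  | all₁ A ih =>
    rw [value, ← Set.sInter_range]
    refine M.adequate.2.2 _ ?_
    rintro _ ⟨a, rfl⟩
    exact ih _ _
  | all₂ n A ih =>
    rw [value, ← Set.sInter_range]
    refine M.adequate.2.2 _ ?_
    rintro _ ⟨a, rfl⟩
    exact ih _ _

theorem value_saturated (A : Formula L) (I : ℕ → M.Base)
    (J : ∀ n, ℕ → (Fin n → M.Base) → M.R) : Saturated (M.value A I J) :=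
  M.adequate.1 _ (M.value_mem A I J)

theorem value_subst (A : Formula L) (σ : ℕ → L.Term ℕ) (I : ℕ → M.Base)
    (J : ∀ n, ℕ → (Fin n → M.Base) → M.R) :
    M.value (A.subst σ) I J = M.value A (fun x => M.val I (σ x)) J := by
  induction A generalizing σ I J with
  | var n X ts => simp only [Formula.subst, value, val_subst]
  | sym P ts => simp only [Formula.subst, value, val_subst]
  | imp A B ihA ihB => simp only [Formula.subst, value, ihA, ihB]
  | all₁ A ih =>
    simp only [Formula.subst, value, ih]
    refine Set.iInter_congr fun a => ?_
    congr 1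
    funext x
    cases x with
    | zero => rfl
    | succ x =>
      simp only [upTerm, term_relabel_eq_subst, val_subst]
      rfl
  | all₂ n A ih => simp only [Formula.subst, value, ih]

theorem value_rren (A : Formula L) (θ : ℕ → ℕ → ℕ) (I : ℕ → M.Base)
    (J : ∀ n, ℕ → (Fin n → M.Base) → M.R) :
    M.value (A.rren θ) I J = M.value A I (fun m X => J m (θ m X)) := by
  induction A generalizing θ I J with
  | var n X ts => simp only [Formula.rren_var, value]
  | sym P ts => simp only [Formula.rren_sym, value]
  | imp A B ihA ihB => simp only [Formula.rren_imp, value, ihA, ihB]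
  | all₁ A ih => simp only [Formula.rren_all₁, value, ih]
  | all₂ n A ih =>
    simp only [Formula.rren_all₂, value, ih]
    refine Set.iInter_congr fun Φ => ?_
    congr 1
    funext m X
    revert m X
    refine rel_cases n ?_ fun m X => ?_
    · rw [upRel_self_zero, consRel_self_zero, consRel_self_zero]
    · rw [upRel_shiftRel, consRel_shiftRel, consRel_shiftRel]

/-- The assignment giving the values `bs` to the variables below `n`. -/
def appendInd {n : ℕ} (bs : Fin n → M.Base) (I : ℕ → M.Base) : ℕ → M.Base :=
  fun k => if h : k < n then bs ⟨k, h⟩ else I (k - n)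

theorem value_genVar (n X : ℕ) (bs : Fin n → M.Base) (I : ℕ → M.Base)
    (J : ∀ n, ℕ → (Fin n → M.Base) → M.R) :
    M.value (.genVar n X) (M.appendInd bs I) J = J n X bs := by
  simp only [Formula.genVar, value, val, appendInd, Fin.is_lt, dite_true, Fin.eta]

/-- `Φ m X` may have free individual variables beyond its `m` parameters. Evaluating it under
`appendInd bs I` makes the hypothesis stable under first-order binders, where `I` is extended. -/
theorem value_rsubst (A : Formula L) (Φ : ℕ → ℕ → Formula L) (I : ℕ → M.Base)
    (J J' : ∀ n, ℕ → (Fin n → M.Base) → M.R)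
    (h : ∀ m X bs, M.value (Φ m X) (M.appendInd bs I) J = J' m X bs) :
    M.value (A.rsubst Φ) I J = M.value A I J' := by
  induction A generalizing Φ I J J' with
  | var n X ts =>
    rw [Formula.rsubst, value_subst, value, ← h]
    congr 1
    funext k
    unfold argSubst appendInd
    split_ifs <;> rfl
  | sym P ts => simp only [Formula.rsubst, value]
  | imp A B ihA ihB => simp only [Formula.rsubst, value, ihA _ _ _ _ h, ihB _ _ _ _ h]
  | all₁ A ih =>
    simp only [Formula.rsubst, value]
    refine Set.iInter_congr fun a => ih _ _ _ _ fun m X bs => ?_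
    rw [← h, Formula.ren_eq, Formula.rren_id, value_subst]
    congr 1
    funext k
    simp only [appendInd, val]
    rcases lt_or_ge k m with hk | hk
    · simp [hk]
    · have h1 : k + 1 - m = (k - m) + 1 := by omega
      simp [not_lt.2 hk, show ¬ k + 1 < m by omega, h1, consInd]
  | all₂ n A ih =>
    simp only [Formula.rsubst, value]
    refine Set.iInter_congr fun Ψ => ih _ _ _ _ (rel_cases n ?_ fun m X => ?_)
    · intro bs
      rw [consRel_self_zero, consRel_self_zero, value_genVar, consRel_self_zero]
    · intro bs
      rw [consRel_shiftRel, consRel_shiftRel, ← h]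
      refine (M.value_rren _ _ _ _).trans ?_
      congr 1
      funext m X
      rw [consRel_shiftRel]

theorem value_inst₁ (A : Formula L) (a : L.Term ℕ) (I : ℕ → M.Base)
    (J : ∀ n, ℕ → (Fin n → M.Base) → M.R) :
    M.value (A.inst₁ a) I J = M.value A (M.consInd (M.val I a) I) J := by
  rw [Formula.inst₁, value_subst]
  congr 1
  funext k
  cases k <;> rfl

theorem value_shift₁ (A : Formula L) (a : M.Base) (I : ℕ → M.Base)
    (J : ∀ n, ℕ → (Fin n → M.Base) → M.R) :
    M.value A.shift₁ (M.consInd a I) J = M.value A I J := by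
  rw [Formula.shift₁_eq, value_subst]
  rfl

theorem value_shift₂ (n : ℕ) (A : Formula L) (Φ : (Fin n → M.Base) → M.R) (I : ℕ → M.Base)
    (J : ∀ n, ℕ → (Fin n → M.Base) → M.R) :
    M.value (A.shift₂ n) I (consRel (β := fun m => (Fin m → M.Base) → M.R) n Φ J) =
      M.value A I J := by
  refine (M.value_rren _ _ _ _).trans ?_
  congr 1
  funext m X
  rw [consRel_shiftRel]

theorem value_inst₂ (n : ℕ) (A F : Formula L) (I : ℕ → M.Base)
    (J : ∀ n, ℕ → (Fin n → M.Base) → M.R) :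
    M.value (A.inst₂ n F) I J = M.value A I (consRel (β := fun m => (Fin m → M.Base) → M.R) n
      (fun bs => ⟨M.value F (M.appendInd bs I) J, M.value_mem _ _ _⟩) J) := by
  refine M.value_rsubst _ _ _ _ _ (rel_cases n ?_ fun m X => ?_)
  · intro bs
    rw [consRel_self_zero, consRel_self_zero]
  · intro bs
    rw [consRel_shiftRel, consRel_shiftRel, value_genVar]

variable {M} in
theorem Satisfies.val_eq {E : Set (L.Term ℕ × L.Term ℕ)} (hM : M.Satisfies E) {a b : L.Term ℕ}
    (h : IsCase E a b) (I : ℕ → M.Base) : M.val I a = M.val I b := by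
  obtain ⟨e, he, σ, ⟨rfl, rfl⟩ | ⟨rfl, rfl⟩⟩ := h
  · rw [val_subst, val_subst, hM e he]
  · rw [val_subst, val_subst, hM e he]

end Model

theorem Typed₀.sound {E : Set (L.Term ℕ × L.Term ℕ)} {Γ : List (Formula L)} {t : Lam}
    {A : Formula L} (h : Typed₀ E Γ t A) {M : Model.{u, v, w} L} (hM : M.Satisfies E)
    (I : ℕ → M.Base) (J : ∀ n, ℕ → (Fin n → M.Base) → M.R) (σ : ℕ → Lam)
    (hσ : ∀ (x : ℕ) (B : Formula L), Γ[x]? = some B → σ x ∈ M.value B I J) :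
    t.subst σ ∈ M.value A I J := by
  induction h generalizing I J σ with
  | ax h => exact hσ _ _ h
  | @lam Γ t A B _ ih =>
    intro s hs
    -- By saturation it is enough to treat the contractum of the head redex.
    refine M.value_saturated B I J _ ((t.subst (Lam.up σ)).inst s) ?_ (.single (.beta _ _))
    rw [Lam.subst_up_inst]
    refine ih I J _ ?_
    rintro (_ | x) C hC
    · simp only [List.getElem?_cons_zero, Option.some.injEq] at hC
      exact hC ▸ hs
    · exact hσ x C (by simpa using hC)
  | app _ _ ih ih' => exact ih I J σ hσ _ (ih' I J σ hσ)
  | all₁_intro _ ih =>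
    refine Set.mem_iInter.2 fun a => ih _ J σ fun x B hB => ?_
    rw [List.getElem?_map, Option.map_eq_some_iff] at hB
    obtain ⟨C, hC, rfl⟩ := hB
    rw [M.value_shift₁]
    exact hσ x C hC
  | all₁_elim a _ ih =>
    rw [M.value_inst₁]
    exact Set.mem_iInter.1 (ih I J σ hσ) _
  | all₂_intro _ ih =>
    refine Set.mem_iInter.2 fun Φ => ih I _ σ fun x B hB => ?_
    rw [List.getElem?_map, Option.map_eq_some_iff] at hB
    obtain ⟨C, hC, rfl⟩ := hB
    rw [M.value_shift₂]
    exact hσ x C hC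
  | all₂_elim_var Y _ ih =>
    rw [M.value_inst₂]
    exact Set.mem_iInter.1 (ih I J σ hσ) _
  | all₂_elim_sym P _ ih =>
    rw [M.value_inst₂]
    exact Set.mem_iInter.1 (ih I J σ hσ) _
  | eq hab _ ih =>
    rw [M.value_inst₁, ← hM.val_eq hab, ← M.value_inst₁]
    exact ih I J σ hσ

/-! ### Structural properties of typing -/

/-- Only the declarations of the free variables of `t` matter. This makes it meaningful to type a
term in an infinite context through arbitrary finite contexts that agree with it. -/
theorem Typed₀.ren {E : Set (L.Term ℕ × L.Term ℕ)} {Γ : List (Formula L)} {t : Lam}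
    {A : Formula L} (h : Typed₀ E Γ t A) {Δ : List (Formula L)} {ρ : ℕ → ℕ}
    (hρ : ∀ x, t.HasVar x → Δ[ρ x]? = Γ[x]?) : Typed₀ E Δ (t.ren ρ) A := by
  induction h generalizing Δ ρ with
  | ax h => exact .ax ((hρ _ rfl).trans h)
  | lam _ ih =>
    refine .lam (ih ?_)
    rintro (_ | x) hx
    · rfl
    · simpa [upRen] using hρ x hx
  | app _ _ ih ih' =>
    exact .app (ih fun x hx => hρ x (.inl hx)) (ih' fun x hx => hρ x (.inr hx))
  | all₁_intro _ ih =>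
    exact .all₁_intro (ih fun x hx => by rw [List.getElem?_map, List.getElem?_map, hρ x hx])
  | all₁_elim a _ ih => exact .all₁_elim a (ih hρ)
  | all₂_intro _ ih =>
    exact .all₂_intro (ih fun x hx => by rw [List.getElem?_map, List.getElem?_map, hρ x hx])
  | all₂_elim_var Y _ ih => exact .all₂_elim_var Y (ih hρ)
  | all₂_elim_sym P _ ih => exact .all₂_elim_sym P (ih hρ)
  | eq hab _ ih => exact .eq hab (ih hρ)

theorem Typed₀.of_agree {E : Set (L.Term ℕ × L.Term ℕ)} {Γ Δ : List (Formula L)} {t : Lam}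
    {A : Formula L} (h : Typed₀ E Γ t A) (hΔ : ∀ x, t.HasVar x → Δ[x]? = Γ[x]?) :
    Typed₀ E Δ t A := by
  have := h.ren (Δ := Δ) (ρ := id) hΔ
  rwa [Lam.ren_eq_self (ρ := id) fun _ _ => rfl] at this

theorem Typed₀.rren {E : Set (L.Term ℕ × L.Term ℕ)} {Γ : List (Formula L)} {t : Lam}
    {A : Formula L} (h : Typed₀ E Γ t A) (θ : ℕ → ℕ → ℕ) :
    Typed₀ E (Γ.map (·.rren θ)) t (A.rren θ) := by
  induction h generalizing θ with
  | ax h => exact .ax (by rw [List.getElem?_map, h]; rfl)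
  | lam _ ih => exact .lam (ih θ)
  | app _ _ ih ih' => exact .app (ih θ) (ih' θ)
  | all₁_intro _ ih =>
    rw [Formula.rren_all₁]
    refine .all₁_intro ?_
    have := ih θ
    rw [List.map_map] at this ⊢
    simpa only [Function.comp_def, Formula.rren_shift₁] using this
  | all₁_elim a _ ih =>
    rw [Formula.inst₁_rren]
    have := ih θ
    rw [Formula.rren_all₁] at this
    exact .all₁_elim a this
  | @all₂_intro _ _ n _ _ ih =>
    refine .all₂_intro ?_
    have := ih (upRel n θ)
    rw [List.map_map] at this ⊢
    simpa only [Function.comp_def, Formula.rren_shift₂] using this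
  | all₂_elim_var Y _ ih =>
    rw [Formula.inst₂_genVar, Formula.rren_instRel_rren, ← Formula.inst₂_genVar]
    exact .all₂_elim_var _ (ih θ)
  | all₂_elim_sym P _ ih =>
    rw [Formula.inst₂_genSym_rren]
    exact .all₂_elim_sym P (ih θ)
  | eq hab _ ih =>
    rw [Formula.inst₁_rren]
    refine .eq hab ?_
    rw [← Formula.inst₁_rren]
    exact ih θ

/-- Generalization over a relation variable that is not free in the context. -/
theorem Typed₀.generalize {E : Set (L.Term ℕ × L.Term ℕ)} {Γ : List (Formula L)} {t : Lam}
    {n : ℕ} {A : Formula L} {Y : ℕ} (h : Typed₀ E Γ t (A.rren (instRel n Y)))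
    (hΓ : ∀ B ∈ Γ, ¬ B.HasRel n Y) (hA : ¬ (Formula.all₂ n A).HasRel n Y) :
    Typed₀ E Γ t (.all₂ n A) := by
  refine .all₂_intro ?_
  -- This renaming makes `Y` the bound index `0` and shifts every other variable. It undoes `instRel
  -- n Y` on `A` because `Y` is not free in `∀X A`.
  have := h.rren (fun m X => if m = n ∧ X = Y then 0 else shiftRel n m X)
  rw [Formula.rren_rren, Formula.rren_eq_self] at this
  · convert this using 1
    refine List.map_congr_left fun B hB => Formula.rren_congr fun m X hX => ?_
    have : ¬ (m = n ∧ X = Y) := by rintro ⟨rfl, rfl⟩; exact hΓ B hB hX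
    rw [if_neg this]
  · refine rel_cases n ?_ fun m X => ?_
    · intro _
      rw [instRel, consRel_self_zero, if_pos ⟨rfl, rfl⟩]
    · intro hX
      have : ¬ (m = n ∧ X = Y) := by rintro ⟨rfl, rfl⟩; exact hA hX
      rw [instRel, consRel_shiftRel, if_neg this]

theorem Typed₀.sim {E : Set (L.Term ℕ × L.Term ℕ)} {Γ : List (Formula L)} {t : Lam}
    {A B : Formula L} (h : Typed₀ E Γ t A) (hAB : Sim E A B) : Typed₀ E Γ t B := by
  induction hAB with
  | refl => exact h
  | tail _ hs ih =>
    obtain ⟨C, a, b, hab, rfl, rfl⟩ := hs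
    exact .eq hab ih

/-! ### The relation `∼` -/

variable {E : Set (L.Term ℕ × L.Term ℕ)}

theorem SimStep.symm {A B : Formula L} (h : SimStep E A B) : SimStep E B A := by
  obtain ⟨C, a, b, ⟨e, he, σ, h⟩, rfl, rfl⟩ := h
  exact ⟨C, b, a, ⟨e, he, σ, h.symm.imp And.symm And.symm⟩, rfl, rfl⟩

theorem Sim.symm {A B : Formula L} (h : Sim E A B) : Sim E B A := by
  induction h with
  | refl => exact .refl
  | tail _ hs ih => exact .head hs.symm ih

theorem Sim.map {A B : Formula L} (h : Sim E A B) (F : Formula L → Formula L)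
    (hF : ∀ A B, SimStep E A B → SimStep E (F A) (F B)) : Sim E (F A) (F B) := by
  induction h with
  | refl => exact .refl
  | tail _ hs ih => exact ih.tail (hF _ _ hs)

theorem Sim.imp_left {A B : Formula L} (h : Sim E A B) (C : Formula L) :
    Sim E (.imp A C) (.imp B C) := by
  refine h.map (Formula.imp · C) ?_
  rintro _ _ ⟨D, a, b, hab, rfl, rfl⟩
  exact ⟨.imp D C.shift₁, a, b, hab, congrArg (Formula.imp _) (C.shift₁_inst₁ a).symm,
    congrArg (Formula.imp _) (C.shift₁_inst₁ b).symm⟩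

theorem Sim.imp_right {A B : Formula L} (h : Sim E A B) (C : Formula L) :
    Sim E (.imp C A) (.imp C B) := by
  refine h.map (Formula.imp C ·) ?_
  rintro _ _ ⟨D, a, b, hab, rfl, rfl⟩
  exact ⟨.imp C.shift₁ D, a, b, hab, congrArg (Formula.imp · _) (C.shift₁_inst₁ a).symm,
    congrArg (Formula.imp · _) (C.shift₁_inst₁ b).symm⟩

/-- Equational replacement acts inside the terms of atoms only, so it preserves the connectives and
acts on the two sides of an arrow separately. -/
theorem Sim.of_imp {G B C : Formula L} (h : Sim E G (.imp B C)) :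
    ∃ B' C', G = .imp B' C' ∧ Sim E B' B ∧ Sim E C' C := by
  induction h using ReflTransGen.head_induction_on with
  | refl => exact ⟨B, C, rfl, .refl, .refl⟩
  | head hs _ ih =>
    obtain ⟨B', C', rfl, hB, hC⟩ := ih
    obtain ⟨D, a, b, hab, rfl, e⟩ := hs
    cases D with
    | imp D₁ D₂ =>
      cases e
      exact ⟨_, _, rfl, .head ⟨D₁, a, b, hab, rfl, rfl⟩ hB, .head ⟨D₂, a, b, hab, rfl, rfl⟩ hC⟩
    | _ => cases e

theorem Sim.of_foldr_imp {Cs : List (Formula L)} {G C : Formula L}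
    (h : Sim E G (Cs.foldr .imp C)) : ∃ (Cs' : List (Formula L)) (C' : Formula L), G = Cs'.foldr .imp C' ∧ Sim E C' C := by
  induction Cs generalizing G with
  | nil => exact ⟨[], G, rfl, h⟩
  | cons B Cs ih =>
    obtain ⟨B', G', rfl, -, hG⟩ := h.of_imp
    obtain ⟨Cs', C', rfl, hC⟩ := ih hG
    exact ⟨B' :: Cs', C', rfl, hC⟩

theorem Sim.of_all₁ {G B : Formula L} (h : Sim E G (.all₁ B)) :
    ∃ B', G = .all₁ B' ∧ ∀ c, Sim E (B'.inst₁ c) (B.inst₁ c) := by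
  induction h using ReflTransGen.head_induction_on with
  | refl => exact ⟨B, rfl, fun _ => .refl⟩
  | head hs _ ih =>
    obtain ⟨B', rfl, hB⟩ := ih
    obtain ⟨D, a, b, hab, rfl, e⟩ := hs
    cases D with
    | all₁ D =>
      cases e
      -- The replaced place `a` and the instance `c` are filled in the opposite order. Once the
      -- replaced place is the variable `0`, the term `c` has to be shifted past it.
      have key : ∀ c a : L.Term ℕ, (D.subst (upTerm (instTerm a))).inst₁ c =
          (D.subst (fun | 0 => c.subst (fun x => .var (x + 1)) | k + 1 => .var k)).inst₁ a := by
        intro c a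
        rw [Formula.subst_upTerm_inst₁, Formula.inst₁, Formula.subst_subst]
        refine Formula.subst_congr fun x _ => ?_
        cases x with
        | zero => exact ((term_subst_subst _ _ _).trans (term_subst_var c)).symm
        | succ x => rfl
      refine ⟨_, rfl, fun c => .head ⟨_, a, b, hab, key c a, ?_⟩ (hB c)⟩
      exact key c b
    | _ => cases e

theorem Sim.hasRel {A B : Formula L} (h : Sim E A B) {n X : ℕ} :
    A.HasRel n X ↔ B.HasRel n X := by
  induction h with
  | refl => rfl
  | tail _ hs ih =>
    obtain ⟨C, a, b, -, rfl, rfl⟩ := hs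
    exact ih.trans (Formula.hasRel_subst.trans Formula.hasRel_subst.symm)

/-! ### Instantiation of first-order quantifiers -/

/-- One instantiation of a head first-order quantifier. -/
inductive FoInst : Formula L → Formula L → Prop
  | mk (A : Formula L) (a : L.Term ℕ) : FoInst (.all₁ A) (A.inst₁ a)

/-- Instantiation of head first-order quantifiers. -/
def FoLe : Formula L → Formula L → Prop := ReflTransGen FoInst

/-- First-order instantiation is all that declared variables need, since a negative type contains no
second-order quantifier at its head. This inclusion connects it with the `≤` of condition (*). -/
theorem FoLe.le {A B : Formula L} (h : FoLe A B) : Le A B := by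
  induction h with
  | refl => exact .refl
  | tail _ hs ih =>
    obtain ⟨A, a⟩ := hs
    exact ih.tail (.first A a)

theorem FoLe.hasRel {A B : Formula L} (h : FoLe A B) {n X : ℕ} :
    B.HasRel n X → A.HasRel n X := by
  induction h with
  | refl => exact id
  | tail _ hs ih =>
    obtain ⟨D, a⟩ := hs
    exact fun h => ih (show D.HasRel n X from Formula.hasRel_subst.1 h)

theorem FoLe.typed {A B : Formula L} (h : FoLe A B) {Γ : List (Formula L)} {t : Lam}
    (ht : Typed₀ E Γ t A) : Typed₀ E Γ t B := by
  induction h with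
  | refl => exact ht
  | tail _ hs ih =>
    obtain ⟨A, a⟩ := hs
    exact .all₁_elim a ih

/-! ### Polarities -/

theorem startsAll₁_subst {A : Formula L} {σ : ℕ → L.Term ℕ} :
    (A.subst σ).StartsAll₁ ↔ A.StartsAll₁ := by cases A <;> rfl

theorem startsAll₁_rren {A : Formula L} {θ : ℕ → ℕ → ℕ} :
    (A.rren θ).StartsAll₁ ↔ A.StartsAll₁ := by cases A <;> rfl

theorem polar_subst {s : Sign} {A : Formula L} {σ : ℕ → L.Term ℕ} :
    Polar s (A.subst σ) ↔ Polar s A := by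
  induction A generalizing s σ with
  | var | sym => cases s <;> rfl
  | imp A B ihA ihB =>
    cases s <;> simp only [Formula.subst, Polar, ihA, ihB, startsAll₁_subst]
  | all₁ A ih => cases s <;> simp only [Formula.subst, Polar, ih]
  | all₂ n A ih => cases s <;> simp only [Formula.subst, Polar, ih, Formula.hasRel_subst]

theorem Polar.rren {s : Sign} {A : Formula L} (h : Polar s A) (θ : ℕ → ℕ → ℕ) :
    Polar s (A.rren θ) := by
  induction A generalizing s θ with
  | var | sym => cases s <;> trivial
  | imp A B ihA ihB =>
    cases s with
    | pos => exact ⟨ihA h.1 θ, ihB h.2 θ⟩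
    | neg => exact ⟨ihA h.1 θ, ihB h.2.1 θ, fun h' => h.2.2 (startsAll₁_rren.1 h')⟩
  | all₁ A ih =>
    rw [Formula.rren_all₁]
    cases s with
    | pos => exact h
    | neg => exact ih h θ
  | all₂ n A ih =>
    cases s with
    | pos => exact ⟨ih h.1 _, Formula.hasRel_rren.2 ⟨0, h.2, upRel_self_zero ..⟩⟩
    | neg => exact h

theorem Sim.polar {s : Sign} {A B : Formula L} (h : Sim E A B) : Polar s A ↔ Polar s B := by
  induction h with
  | refl => rfl
  | tail _ hs ih =>
    obtain ⟨C, a, b, -, rfl, rfl⟩ := hs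
    exact ih.trans (polar_subst.trans polar_subst.symm)

theorem FoLe.polar {A B : Formula L} (h : FoLe A B) (hA : Polar .neg A) : Polar .neg B := by
  induction h with
  | refl => exact hA
  | tail _ hs ih =>
    obtain ⟨A, a⟩ := hs
    exact polar_subst.2 ih

/-- This is where the side condition in the definition of `∀⁻` is used: no quantifier can be
eliminated after a variable has received an argument. -/
theorem not_startsAll₁_of_polar {Cs : List (Formula L)} {C : Formula L}
    (h : Polar .neg (Cs.foldr .imp C)) (hCs : Cs ≠ []) : ¬ C.StartsAll₁ := by
  induction Cs with
  | nil => exact absurd rfl hCs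
  | cons B Cs ih =>
    rcases eq_or_ne Cs [] with rfl | hne
    · exact h.2.2
    · exact ih h.2.1 hne

end

/-! ### Subtypes -/

/-- Composition of polarities. -/
def Sign.comp : Sign → Sign → Sign
  | pos, s => s
  | neg, s => s.flip

section
variable {L : FirstOrder.Language.{u, v}} {nm : List Dir → ℕ → ℕ}

/-- A subtype of a non-atomic subtype at the path `q` is a subtype; the free variables of a subtype
are free in the whole type or attached to quantifiers at shorter paths. -/
theorem SubtypeAt.trans {p : List Dir} {s : Sign} {A T : Formula L} (h : SubtypeAt nm p s A T)
    (hT : ¬ T.IsAtomic) : ∃ q : List Dir, p.length ≤ q.length ∧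
      (∀ s' S, SubtypeAt nm q s' T S → SubtypeAt nm p (s.comp s') A S) ∧
      (∀ y, T.HasInd y → A.HasInd y ∨ ∃ q' i, y = nm q' i ∧ q'.length < q.length) ∧
      ∀ n y, T.HasRel n y → A.HasRel n y ∨ ∃ q' i, y = nm q' i ∧ q'.length < q.length := by
  induction h with
  | self p A => exact ⟨p, le_rfl, fun _ _ => id, fun _ => .inl, fun _ _ => .inl⟩
  | atom p s A h => exact absurd h hT
  | @impL p s B S C h ih =>
    obtain ⟨q, hq, hs, hi, hr⟩ := ih hT
    refine ⟨q, (Nat.le_succ _).trans hq, fun s' S hS => ?_, fun y hy => (hi y hy).imp_left .inl,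
      fun n y hy => (hr n y hy).imp_left .inl⟩
    have := (hs s' S hS).impL C
    cases s <;> cases s' <;> exact this
  | @impR p s C S B h ih =>
    obtain ⟨q, hq, hs, hi, hr⟩ := ih hT
    exact ⟨q, (Nat.le_succ _).trans hq, fun s' S hS => .impR B (hs s' S hS),
      fun y hy => (hi y hy).imp_left .inr, fun n y hy => (hr n y hy).imp_left .inr⟩
  | @all₁ p s B S i h ih =>
    obtain ⟨q, hq, hs, hi, hr⟩ := ih hT
    refine ⟨q, (Nat.le_succ _).trans hq, fun s' S hS => .all₁ i (hs s' S hS), fun y hy => ?_,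
      fun n y hy => (hr n y hy).imp_left fun h => show B.HasRel n y from Formula.hasRel_subst.1 h⟩
    rcases hi y hy with h | h
    · rcases Formula.hasInd_inst₁_var h with rfl | h
      · exact .inr ⟨p, i, rfl, hq⟩
      · exact .inl h
    · exact .inr h
  | @all₂ p s n B S i h ih =>
    obtain ⟨q, hq, hs, hi, hr⟩ := ih hT
    rw [Formula.inst₂_genVar] at hi hr
    refine ⟨q, (Nat.le_succ _).trans hq, fun s' S hS => .all₂ i (hs s' S hS),
      fun y hy => (hi y hy).imp_left fun h => show B.HasInd y from Formula.hasInd_rren.1 h, fun m y hy => ?_⟩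
    rcases hr m y hy with h | h
    · rcases Formula.hasRel_rren_instRel h with ⟨rfl, rfl⟩ | h
      · exact .inr ⟨p, i, rfl, hq⟩
      · exact .inl h
    · exact .inr h

theorem SubtypeAt.polar {p : List Dir} {s s₀ : Sign} {A T : Formula L}
    (h : SubtypeAt nm p s A T) (hA : Polar s₀ A) : Polar (s₀.comp s) T := by
  induction h generalizing s₀ with
  | self p A => cases s₀ <;> exact hA
  | atom p s A h =>
    cases A with
    | var | sym => generalize s₀.comp s = s'; cases s' <;> trivial
    | _ => cases h
  | @impL p s B S C h ih =>
    have := ih (s₀ := s₀.flip) (by cases s₀ <;> exact hA.1)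
    cases s <;> cases s₀ <;> exact this
  | impR B h ih =>
    cases s₀
    · exact ih (s₀ := .pos) hA.2
    · exact ih (s₀ := .neg) hA.2.1
  | all₁ i h ih =>
    cases s₀
    · cases hA
    · exact ih (s₀ := .neg) (polar_subst.2 hA)
  | all₂ i h ih =>
    cases s₀
    · refine ih (s₀ := .pos) ?_
      rw [Formula.inst₂_genVar]
      exact hA.1.rren _
    · cases hA

theorem SubtypeSubst.polar {s : Sign} {A S : Formula L} (h : SubtypeSubst nm s A S)
    (hA : Polar .pos A) : Polar s S := by
  obtain ⟨T, σ, hT, rfl⟩ := h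
  exact polar_subst.2 (hT.polar hA)

theorem SubtypeSubst.imp_left {s : Sign} {A B C : Formula L}
    (h : SubtypeSubst nm s A (.imp B C)) : SubtypeSubst nm s.flip A B := by
  obtain ⟨T, σ, hT, e⟩ := h
  cases T with
  | imp B₀ C₀ =>
    cases e
    obtain ⟨q, -, hs, -⟩ := hT.trans id
    refine ⟨B₀, σ, ?_, rfl⟩
    have := hs _ _ (.impL C₀ (.self _ B₀))
    cases s <;> exact this
  | _ => cases e

theorem SubtypeSubst.imp_right {s : Sign} {A B C : Formula L}
    (h : SubtypeSubst nm s A (.imp B C)) : SubtypeSubst nm s A C := by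
  obtain ⟨T, σ, hT, e⟩ := h
  cases T with
  | imp B₀ C₀ =>
    cases e
    obtain ⟨q, -, hs, -⟩ := hT.trans id
    refine ⟨C₀, σ, ?_, rfl⟩
    have := hs _ _ (.impR B₀ (.self _ C₀))
    cases s <;> exact this
  | _ => cases e

theorem length_ne_of_nm_eq (hnm : Function.Injective (Function.uncurry nm)) {q : List Dir} {i : ℕ} :
    ¬ ∃ q' j, nm q i = nm q' j ∧ q'.length < q.length := by
  rintro ⟨q', j, e, h⟩
  have := @hnm (q, i) (q', j) e
  cases this
  exact lt_irrefl _ h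

/-- The name `nm q 0` attached to this quantifier is not free in the underlying subtype, by
closedness of `A` and injectivity of `nm`. Hence the substitution can be redefined there as `a`
without disturbing anything else. -/
theorem SubtypeSubst.inst₁ {s : Sign} {A B : Formula L}
    (hnm : Function.Injective (Function.uncurry nm)) (hA : A.Closed)
    (h : SubtypeSubst nm s A (.all₁ B)) (a : L.Term ℕ) : SubtypeSubst nm s A (B.inst₁ a) := by
  obtain ⟨T, σ, hT, e⟩ := h
  cases T with
  | all₁ B₀ =>
    cases e
    obtain ⟨q, -, hs, hi, -⟩ := hT.trans id
    have hy : ¬ (Formula.all₁ B₀).HasInd (nm q 0) := fun hy =>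
      (hi _ hy).elim (hA.1 _) (length_ne_of_nm_eq hnm)
    have := hs _ _ (.all₁ 0 (.self _ _))
    refine ⟨B₀.inst₁ (.var (nm q 0)), Function.update σ (nm q 0) a,
      by cases s <;> exact this, ?_⟩
    rw [Formula.subst_upTerm_inst₁, Formula.inst₁, Formula.subst_subst]
    refine Formula.subst_congr fun x hx => ?_
    cases x with
    | zero => exact (Function.update_self (nm q 0) a σ).symm
    | succ x =>
      have hne : x ≠ nm q 0 := by
        rintro rfl
        exact hy hx
      exact (Function.update_of_ne hne a σ).symm
  | _ => cases e

/-- Infinitely many names are provided so that one can later be chosen outside a given finite set.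
-/
theorem SubtypeSubst.inst₂ {s : Sign} {n : ℕ} {A B : Formula L}
    (hnm : Function.Injective (Function.uncurry nm)) (hA : A.Closed)
    (h : SubtypeSubst nm s A (.all₂ n B)) : ∃ f : ℕ → ℕ, Function.Injective f ∧
      ∀ i, SubtypeSubst nm s A (B.rren (instRel n (f i))) ∧
        ¬ (Formula.all₂ n B).HasRel n (f i) := by
  obtain ⟨T, σ, hT, e⟩ := h
  cases T with
  | all₂ m B₀ =>
    cases e
    obtain ⟨q, -, hs, -, hr⟩ := hT.trans id
    refine ⟨nm q, fun i j e => congrArg Prod.snd (@hnm (q, i) (q, j) e), fun i => ⟨?_, ?_⟩⟩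
    · have := hs _ _ (.all₂ i (.self _ _))
      rw [Formula.inst₂_genVar] at this
      refine ⟨_, σ, ?_, (Formula.rren_subst _ _ _).symm⟩
      cases s <;> exact this
    · intro h
      exact (hr n _ (Formula.hasRel_subst.1 h)).elim (hA.2 _ _) (length_ne_of_nm_eq hnm)
  | _ => cases e

/-! ### Countability of the subtypes with substitution -/

theorem countable_subtypeAt (k : ℕ) : ∀ (p : List Dir) (A : Formula L), A.size < k →
    {S | ∃ s, SubtypeAt nm p s A S}.Countable := by
  induction k with
  | zero => intro _ _ h; omega
  | succ k ih =>
    intro p A hA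
    cases A with
    | var n X ts =>
      refine (Set.countable_singleton (Formula.var n X ts)).mono ?_
      rintro S ⟨s, h⟩
      cases h <;> rfl
    | sym P ts =>
      refine (Set.countable_singleton (Formula.sym P ts)).mono ?_
      rintro S ⟨s, h⟩
      cases h <;> rfl
    | imp B C =>
      simp only [Formula.size] at hA
      refine (((ih (.left :: p) B (by omega)).union (ih (.right :: p) C (by omega))).insert
        (.imp B C)).mono ?_
      rintro S ⟨s, h⟩
      cases h with
      | self => exact .inl rfl
      | atom => exact .inl rfl
      | impL _ h => exact .inr (.inl ⟨_, h⟩)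
      | impR _ h => exact .inr (.inr ⟨_, h⟩)
    | all₁ B =>
      simp only [Formula.size] at hA
      refine ((Set.countable_iUnion fun i => ih (.body :: p) (B.inst₁ (.var (nm p i)))
        (by rw [Formula.inst₁, Formula.size_subst]; omega)).insert (.all₁ B)).mono ?_
      rintro S ⟨s, h⟩
      cases h with
      | self => exact .inl rfl
      | atom => exact .inl rfl
      | all₁ i h => exact .inr (Set.mem_iUnion.2 ⟨i, _, h⟩)
    | all₂ n B =>
      simp only [Formula.size] at hA
      refine ((Set.countable_iUnion fun i => ih (.body :: p) (B.inst₂ n (.genVar n (nm p i)))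
        (by rw [Formula.inst₂_genVar, Formula.size_rren]; omega)).insert (.all₂ n B)).mono ?_
      rintro S ⟨s, h⟩
      cases h with
      | self => exact .inl rfl
      | atom => exact .inl rfl
      | all₂ i h => exact .inr (Set.mem_iUnion.2 ⟨i, _, h⟩)

/-- There may be uncountably many substitutions, but each atom of `A` sees only finitely many
argument terms. Relation symbols are left unchanged, so their number plays no role. -/
theorem countable_range_subst [Countable (L.Term ℕ)] (A : Formula L) :
    (Set.range fun σ : ℕ → L.Term ℕ => A.subst σ).Countable := by
  induction A with
  | var n X ts =>
    refine (Set.countable_range (Formula.var n X)).mono ?_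
    rintro _ ⟨σ, rfl⟩
    exact ⟨_, rfl⟩
  | sym P ts =>
    refine (Set.countable_range (Formula.sym P)).mono ?_
    rintro _ ⟨σ, rfl⟩
    exact ⟨_, rfl⟩
  | imp A B ihA ihB =>
    refine (ihA.image2 ihB Formula.imp).mono ?_
    rintro _ ⟨σ, rfl⟩
    exact ⟨_, ⟨σ, rfl⟩, _, ⟨σ, rfl⟩, rfl⟩
  | all₁ A ih =>
    refine (ih.image Formula.all₁).mono ?_
    rintro _ ⟨σ, rfl⟩
    exact ⟨_, ⟨upTerm σ, rfl⟩, rfl⟩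
  | all₂ n A ih =>
    refine (ih.image (Formula.all₂ n)).mono ?_
    rintro _ ⟨σ, rfl⟩
    exact ⟨_, ⟨σ, rfl⟩, rfl⟩

theorem countable_subtypeSubst [Countable (L.Term ℕ)] (s : Sign) (A : Formula L) :
    {S | SubtypeSubst nm s A S}.Countable := by
  refine ((countable_subtypeAt (nm := nm) _ [] A (Nat.lt_succ_self _)).biUnion
    fun T _ => countable_range_subst T).mono ?_
  rintro _ ⟨T, σ, hT, rfl⟩
  exact Set.mem_biUnion (show T ∈ {S | ∃ s, SubtypeAt nm [] s A S} from ⟨s, hT⟩) ⟨σ, rfl⟩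

theorem exists_injective_nm : ∃ nm : List Dir → ℕ → ℕ, Function.Injective (Function.uncurry nm) := by
  have : Countable Dir := by
    refine Function.Injective.countable (β := ℕ)
      (f := fun | .left => 0 | .right => 1 | .body => 2) ?_
    rintro (_ | _ | _) (_ | _ | _) h <;> first | rfl | cases h
  obtain ⟨f, hf⟩ := exists_injective_nat (List Dir × ℕ)
  exact ⟨Function.curry f, by rwa [Function.uncurry_curry]⟩

/-- A sequence in which every member of a countable set occurs infinitely often, with no entries at
indices below `k`. -/
theorem exists_enumeration {α : Type*} {N : Set α} (hN : N.Countable) (k : ℕ) :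
    ∃ Γ : ℕ → Option α, (∀ x < k, Γ x = none) ∧ (∀ x a, Γ x = some a → a ∈ N) ∧
      ∀ a ∈ N, {x | Γ x = some a}.Infinite := by
  -- Adding `none` keeps the set non-empty even when `N` is empty. Reading `e` at the first
  -- component of `Nat.unpair` repeats every value infinitely often.
  obtain ⟨e, he⟩ := ((hN.image some).insert none).exists_eq_range (Set.insert_nonempty _ _)
  refine ⟨fun x => if x < k then none else e x.unpair.1, fun x hx => if_pos hx, ?_, ?_⟩
  · intro x a h
    dsimp only at h
    split_ifs at h
    have : some a ∈ insert none (some '' N) := he ▸ ⟨_, h⟩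
    simpa using this
  · intro a ha
    have : some a ∈ Set.range e := he ▸ .inr ⟨a, ha, rfl⟩
    obtain ⟨j, hj⟩ := this
    refine Set.infinite_of_not_bddAbove ?_
    rintro ⟨b, hb⟩
    have h₁ := Nat.right_le_pair j (k + b + 1)
    have := hb (a := Nat.pair j (k + b + 1)) (by
      simp only [Set.mem_ofPred_eq, Nat.unpair_pair, hj, ite_eq_right_iff]
      omega)
    omega

end

section
variable {L : FirstOrder.Language.{u, v}} (E : Set (L.Term ℕ × L.Term ℕ))
  (Γ : ℕ → Option (Formula L))

/-! ### Normal terms typed in an infinite context -/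

/-- `t : A` in the infinite context `Γ`. -/
def TypedIn (t : Lam) (A : Formula L) : Prop :=
  (∀ x, t.HasVar x → ∃ D, Γ x = some D) ∧
    ∀ Δ : List (Formula L), (∀ x, t.HasVar x → Δ[x]? = Γ x) → Typed₀ E Δ t A

/-- The type of the variable `x` can be instantiated to `A` up to `∼`. -/
def VarHasType (x : ℕ) (A : Formula L) : Prop :=
  ∃ D G, Γ x = some D ∧ FoLe D G ∧ Sim E G A

/-- `t = x u₁ ⋯ uₙ` has the type `A`, where the arguments have the types `C₁, …, Cₙ`. -/
inductive Neutral : Lam → List (Formula L) → Formula L → Prop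
  | var {x : ℕ} {A : Formula L} (h : VarHasType E Γ x A) : Neutral (.var x) [] A
  | app {t s : Lam} {Cs : List (Formula L)} {B C : Formula L} (h : Neutral t Cs (.imp B C))
      (hs : TypedIn E Γ s B) (hv : ∀ y, s = .var y → VarHasType E Γ y B) :
      Neutral (.app t s) (Cs ++ [B]) C

/-- `t : A`, where `t` is an abstraction or neutral. -/
def NormalIn (t : Lam) (A : Formula L) : Prop :=
  TypedIn E Γ t A ∧ ((∃ s, t = .lam s) ∨ ∃ Cs, Neutral E Γ t Cs A)

variable {E Γ}

theorem exists_context {t : Lam} (h : ∀ x, t.HasVar x → ∃ D, Γ x = some D) :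
    ∃ Δ : List (Formula L), (∀ x, t.HasVar x → Δ[x]? = Γ x) ∧
      ∀ D ∈ Δ, (∀ n Y, ¬ D.HasRel n Y) ∨ ∃ x, t.HasVar x ∧ Γ x = some D := by
  classical
  obtain ⟨k, hk⟩ := t.exists_bound
  -- A closed filler for the positions not free in `t`, so that it can never obstruct a
  -- generalization over a relation variable.
  let c : Formula L := .all₂ 0 (.genVar 0 0)
  refine ⟨(List.range k).map fun x => if t.HasVar x then (Γ x).getD c else c, fun x hx => ?_, ?_⟩
  · obtain ⟨D, hD⟩ := h x hx
    simp [hk x hx, hx, hD]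
  · intro D hD
    obtain ⟨x, -, rfl⟩ := List.mem_map.1 hD
    by_cases hx : t.HasVar x
    · obtain ⟨D, hD⟩ := h x hx
      exact .inr ⟨x, hx, by simp [hx, hD]⟩
    · left
      rintro n Y hY
      rw [if_neg hx] at hY
      obtain ⟨rfl, h⟩ := hY
      rw [shiftRel_self] at h
      omega

/-- A single finite context that agrees with `Γ` on the free variables of `t` suffices, since they
all give the same typings. -/
theorem TypedIn.of_typed {t : Lam} {A : Formula L} (h : ∀ x, t.HasVar x → ∃ D, Γ x = some D)
    {Δ : List (Formula L)} (hΔ : ∀ x, t.HasVar x → Δ[x]? = Γ x) (ht : Typed₀ E Δ t A) :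
    TypedIn E Γ t A :=
  ⟨h, fun _ h' => ht.of_agree fun x hx => (h' x hx).trans (hΔ x hx).symm⟩

theorem TypedIn.sim {t : Lam} {A B : Formula L} (h : TypedIn E Γ t A) (hAB : Sim E A B) :
    TypedIn E Γ t B := ⟨h.1, fun Δ hΔ => (h.2 Δ hΔ).sim hAB⟩

theorem VarHasType.typedIn {x : ℕ} {A : Formula L} (h : VarHasType E Γ x A) :
    TypedIn E Γ (.var x) A := by
  obtain ⟨D, G, hD, hG, hA⟩ := h
  refine ⟨by rintro _ rfl; exact ⟨D, hD⟩, fun Δ hΔ => ?_⟩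
  exact (hG.typed (.ax ((hΔ x rfl).trans hD))).sim hA

theorem VarHasType.sim {x : ℕ} {A B : Formula L} (h : VarHasType E Γ x A) (hAB : Sim E A B) :
    VarHasType E Γ x B := by
  obtain ⟨D, G, hD, hG, hA⟩ := h
  exact ⟨D, G, hD, hG, hA.trans hAB⟩

theorem Neutral.sim {t : Lam} {Cs : List (Formula L)} {A B : Formula L}
    (h : Neutral E Γ t Cs A) (hAB : Sim E A B) : Neutral E Γ t Cs B := by
  induction h generalizing B with
  | var h => exact .var (h.sim hAB)
  | app _ hs hv ih => exact .app (ih (hAB.imp_right _)) hs hv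

theorem Neutral.typedIn {t : Lam} {Cs : List (Formula L)} {A : Formula L}
    (h : Neutral E Γ t Cs A) : TypedIn E Γ t A := by
  induction h with
  | var h => exact h.typedIn
  | app _ hs _ ih =>
    exact ⟨fun x hx => hx.elim (ih.1 x) (hs.1 x), fun Δ hΔ =>
      .app (ih.2 Δ fun x hx => hΔ x (.inl hx)) (hs.2 Δ fun x hx => hΔ x (.inr hx))⟩

/-- Exposes the head variable. Condition (*), the polarity of declared types and the freshness of
relation variables all apply to its type. -/
theorem Neutral.spine {t : Lam} {Cs : List (Formula L)} {A : Formula L}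
    (h : Neutral E Γ t Cs A) : ∃ x, t.HasVar x ∧ VarHasType E Γ x (Cs.foldr .imp A) := by
  induction h with
  | @var x A h => exact ⟨x, rfl, h⟩
  | app _ _ _ ih =>
    obtain ⟨x, hx, h⟩ := ih
    exact ⟨x, .inl hx, by rwa [List.foldr_append]⟩

theorem Neutral.normalIn {t : Lam} {Cs : List (Formula L)} {A : Formula L}
    (h : Neutral E Γ t Cs A) : NormalIn E Γ t A := ⟨h.typedIn, .inr ⟨Cs, h⟩⟩

theorem NormalIn.sim {t : Lam} {A B : Formula L} (h : NormalIn E Γ t A) (hAB : Sim E A B) :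
    NormalIn E Γ t B := ⟨h.1.sim hAB, h.2.imp_right fun ⟨Cs, h⟩ => ⟨Cs, h.sim hAB⟩⟩

theorem NormalIn.varHasType {y : ℕ} {A : Formula L} (h : NormalIn E Γ (.var y) A) :
    VarHasType E Γ y A := by
  obtain ⟨-, ⟨s, e⟩ | ⟨Cs, h⟩⟩ := h
  · cases e
  · cases h with
    | var h => exact h

/-- For a bare variable the instantiation is absorbed into `VarHasType`. With at least one argument
the case is void, since the head type is negative. -/
theorem Neutral.inst₁ {t : Lam} {Cs : List (Formula L)} {B : Formula L}
    (hΓ : ∀ x D, Γ x = some D → Polar .neg D) (h : Neutral E Γ t Cs (.all₁ B)) (a : L.Term ℕ) :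
    Neutral E Γ t Cs (B.inst₁ a) := by
  cases h with
  | var h =>
    obtain ⟨D, G, hD, hG, hA⟩ := h
    obtain ⟨B', rfl, hB⟩ := hA.of_all₁
    exact .var ⟨D, _, hD, hG.tail (.mk B' a), hB a⟩
  | app h hs hv =>
    obtain ⟨x, -, D, G, hD, hG, hA⟩ := (h.app hs hv).spine
    exact absurd trivial
      (not_startsAll₁_of_polar (hA.polar.1 (hG.polar (hΓ x D hD))) (by simp))

theorem TypedIn.lam {t : Lam} {B C : Formula L} {y : ℕ} (hy : Γ y = some B)
    (h : TypedIn E Γ t C) : TypedIn E Γ (.lam (t.ren (absRen y))) (.imp B C) := by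
  have hz : ∀ z, t.HasVar z → z ≠ y → (Lam.lam (t.ren (absRen y))).HasVar z := by
    intro z hz hne
    have := hz.ren (absRen y)
    rwa [absRen, if_neg hne] at this
  refine ⟨fun x hx => ?_, fun Δ hΔ => .lam ?_⟩
  · obtain ⟨z, hz, e⟩ := Lam.hasVar_ren hx
    unfold absRen at e
    split_ifs at e
    cases e
    exact h.1 _ hz
  · obtain ⟨Δ', hΔ', -⟩ := exists_context h.1
    refine (h.2 Δ' hΔ').ren fun z h => ?_
    rw [hΔ' z h]
    rcases eq_or_ne z y with rfl | hne
    · simp [absRen, hy]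
    · simp [absRen, hne, hΔ z (hz z h hne)]

theorem TypedIn.generalize {t : Lam} {n Y : ℕ} {A : Formula L}
    (h : TypedIn E Γ t (A.rren (instRel n Y)))
    (hΓ : ∀ x D, t.HasVar x → Γ x = some D → ¬ D.HasRel n Y)
    (hA : ¬ (Formula.all₂ n A).HasRel n Y) : TypedIn E Γ t (.all₂ n A) := by
  obtain ⟨Δ, hΔ, hD⟩ := exists_context h.1
  refine .of_typed h.1 hΔ ((h.2 Δ hΔ).generalize (fun D hD' => ?_) hA)
  rcases hD D hD' with h | ⟨x, hx, h⟩
  · exact h n Y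
  · exact hΓ x D hx h

/-! ### The canonical model -/

variable (E) in
/-- Terms that can be exchanged in all formulas up to `∼`. -/
def termSetoid : Setoid (L.Term ℕ) where
  r a b := ∀ A : Formula L, Sim E (A.inst₁ a) (A.inst₁ b)
  iseqv := ⟨fun _ _ => .refl, fun h A => (h A).symm, fun h h' A => (h A).trans (h' A)⟩

/-- Arguments are exchanged one at a time, because interchangeability of two terms is stated with a
single variable to be instantiated. -/
theorem rel_of_forall_update {α : Type*} {n : ℕ} (r : α → α → Prop)
    (P : (Fin n → α) → (Fin n → α) → Prop) (refl : ∀ f, P f f)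
    (trans : ∀ f g h, P f g → P g h → P f h)
    (hP : ∀ f i a b, r a b → P (Function.update f i a) (Function.update f i b))
    (f g : Fin n → α) (h : ∀ i, r (f i) (g i)) : P f g := by
  classical
  suffices H : ∀ s : Finset (Fin n), P f (s.piecewise g f) by simpa using H Finset.univ
  intro s
  induction s using Finset.induction_on with
  | empty => simpa using refl f
  | insert j s hj ih =>
    refine trans _ _ _ ih ?_
    rw [Finset.piecewise_insert]
    have := hP (s.piecewise g f) j _ _ (h j)
    rwa [show Function.update (s.piecewise g f) j (f j) = s.piecewise g f from
      Function.update_eq_self_iff.2 (by simp [hj])] at this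

/-- The arguments `ts` with the new variable `0` in the place `i`. -/
def holeArgs {n : ℕ} (ts : Fin n → L.Term ℕ) (i : Fin n) : Fin n → L.Term ℕ :=
  Function.update (fun j => (ts j).subst fun x => .var (x + 1)) i (.var 0)

theorem holeArgs_subst {n : ℕ} (ts : Fin n → L.Term ℕ) (i : Fin n) (a : L.Term ℕ) :
    (fun j => (holeArgs ts i j).subst (instTerm a)) = Function.update ts i a := by
  funext j
  rcases eq_or_ne j i with rfl | h
  · simp [holeArgs, FirstOrder.Language.Term.subst, instTerm]
  · simp only [holeArgs, Function.update_of_ne h]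
    exact (term_subst_subst _ _ _).trans (term_subst_var _)

theorem func_congr {n : ℕ} (f : L.Functions n) (ts ts' : Fin n → L.Term ℕ)
    (h : ∀ i, (termSetoid E).r (ts i) (ts' i)) : (termSetoid E).r (.func f ts) (.func f ts') := by
  refine rel_of_forall_update (termSetoid E).r
    (fun ts ts' => (termSetoid E).r (.func f ts) (.func f ts')) (fun _ => (termSetoid E).refl _)
    (fun _ _ _ => (termSetoid E).trans) (fun ts i a b hab A => ?_) ts ts' h
  -- The variable instantiated in `A` is moved inside `f`, to the `i`-th argument, where the
  -- hypothesis on `a` and `b` applies.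
  have key : ∀ a : L.Term ℕ, A.inst₁ (.func f (Function.update ts i a)) =
      (A.subst (fun | 0 => .func f (holeArgs ts i) | k + 1 => .var (k + 1))).inst₁ a := by
    intro a
    rw [Formula.inst₁, Formula.inst₁, Formula.subst_subst]
    refine Formula.subst_congr fun x _ => ?_
    cases x with
    | zero => exact congrArg (FirstOrder.Language.Term.func f) (holeArgs_subst ts i a).symm
    | succ x => rfl
  rw [key, key]
  exact hab _

theorem sim_var_congr (n X : ℕ) (ts ts' : Fin n → L.Term ℕ)
    (h : ∀ i, (termSetoid E).r (ts i) (ts' i)) : Sim E (.var n X ts) (.var n X ts') := by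
  refine rel_of_forall_update (termSetoid E).r (fun ts ts' => Sim E (.var n X ts) (.var n X ts'))
    (fun _ => .refl) (fun _ _ _ => .trans) (fun ts i a b hab => ?_) ts ts' h
  have := hab (.var n X (holeArgs ts i))
  simpa only [Formula.inst₁, Formula.subst, holeArgs_subst] using this

theorem sim_sym_congr {n : ℕ} (P : L.Relations n) (ts ts' : Fin n → L.Term ℕ)
    (h : ∀ i, (termSetoid E).r (ts i) (ts' i)) : Sim E (.sym P ts) (.sym P ts') := by
  refine rel_of_forall_update (termSetoid E).r (fun ts ts' => Sim E (.sym P ts) (.sym P ts'))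
    (fun _ => .refl) (fun _ _ _ => .trans) (fun ts i a b hab => ?_) ts ts' h
  have := hab (.sym P (holeArgs ts i))
  simpa only [Formula.inst₁, Formula.subst, holeArgs_subst] using this

variable (E) in
/-- The class of a term. -/
def cls (a : L.Term ℕ) : ULift.{w} (Quotient (termSetoid E)) := ⟨Quotient.mk (termSetoid E) a⟩

theorem cls_eq {a b : L.Term ℕ} : cls.{u, v, w} E a = cls E b ↔ (termSetoid E).r a b :=
  ULift.up_inj.trans Quotient.eq

variable (E) in
/-- A representative of a class. -/
noncomputable def rep (q : ULift.{w} (Quotient (termSetoid E))) : L.Term ℕ := q.down.out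

theorem cls_rep (q : ULift.{w} (Quotient (termSetoid E))) : cls E (rep E q) = q :=
  congrArg ULift.up (Quotient.out_eq _)

variable (E Γ) in
/-- The terms that reduce to a normal term of the type `F ts`, where `ts` represent `qs`. -/
def atomSet {n : ℕ} (F : (Fin n → L.Term ℕ) → Formula L)
    (qs : Fin n → ULift.{w} (Quotient (termSetoid E))) : {G : Set Lam | Saturated G} :=
  ⟨{t | ∃ ts, (∀ i, cls E (ts i) = qs i) ∧ ∃ t', BetaRed t t' ∧ NormalIn E Γ t' (F ts)},
    by
    rintro t s ⟨ts, hts, t', h, hn⟩ h'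
    exact ⟨ts, hts, t', h'.trans h, hn⟩⟩

theorem mem_atomSet {n : ℕ} {F : (Fin n → L.Term ℕ) → Formula L}
    (hF : ∀ ts ts' : Fin n → L.Term ℕ, (∀ i, (termSetoid E).r (ts i) (ts' i)) →
      Sim E (F ts) (F ts')) {ts : Fin n → L.Term ℕ} {t : Lam} :
    t ∈ (atomSet.{u, v, w} E Γ F (fun i => cls E (ts i))).1 ↔
      ∃ t', BetaRed t t' ∧ NormalIn E Γ t' (F ts) := by
  constructor
  · rintro ⟨ts', h, t', ht, hn⟩
    exact ⟨t', ht, hn.sim (hF _ _ fun i => cls_eq.1 (h i))⟩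
  · exact fun h => ⟨ts, fun _ => rfl, h⟩

theorem adequate_saturated : Adequate {G : Set Lam | Saturated G} := by
  refine ⟨fun _ => id, fun G _ G' hG' t s hs ht u hu => ?_, fun T hT t s hs ht G hG => ?_⟩
  · exact hG' _ _ (hs u hu) (ht.appL u)
  · exact hT hG t s (hs G hG) ht

variable (E Γ) in
/-- The canonical model. -/
noncomputable def canonical : Model.{u, v, max u w} L where
  Base := ULift.{w} (Quotient (termSetoid E))
  nonempty := ⟨cls E (.var 0)⟩
  R := {G | Saturated G}
  adequate := adequate_saturated
  func f qs := cls E (.func f fun i => rep E (qs i))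
  rel P qs := atomSet E Γ (.sym P) qs

variable (E Γ) in
/-- The class of a term in the canonical model. -/
def canonicalCls (a : L.Term ℕ) : (canonical.{u, v, w} E Γ).Base := cls E a

variable (E Γ) in
/-- The canonical interpretation of the relation variables. -/
noncomputable def canonicalRel (n X : ℕ) (qs : Fin n → (canonical.{u, v, w} E Γ).Base) :
    (canonical.{u, v, w} E Γ).R := atomSet E Γ (.var n X) qs

theorem exists_canonicalCls (q : (canonical.{u, v, w} E Γ).Base) :
    ∃ a, canonicalCls E Γ a = q := ⟨rep E q, cls_rep q⟩

theorem canonical_val (σ : ℕ → L.Term ℕ) (t : L.Term ℕ) :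
    (canonical.{u, v, w} E Γ).val (fun x => canonicalCls E Γ (σ x)) t =
      canonicalCls E Γ (t.subst σ) := by
  induction t with
  | var x => rfl
  | func f ts ih =>
    refine cls_eq.2 (func_congr f _ _ fun i => cls_eq.1 ?_)
    exact (cls_rep _).trans (ih i)

theorem canonical_val_var (t : L.Term ℕ) :
    (canonical.{u, v, w} E Γ).val (fun x => canonicalCls E Γ (.var x)) t =
      canonicalCls E Γ t := by rw [canonical_val, term_subst_var]

/-- Every assignment consists of classes of terms, hence comes from a substitution, and the equation
becomes one of its particular cases. -/
theorem canonical_satisfies : (canonical.{u, v, w} E Γ).Satisfies E := by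
  intro e he I
  choose σ hσ using fun x => exists_canonicalCls (I x)
  rw [← funext hσ, canonical_val, canonical_val]
  exact cls_eq.2 fun A =>
    .single ⟨A, _, _, ⟨e, he, _, .inl ⟨rfl, rfl⟩⟩, rfl, rfl⟩

variable (E Γ) in
/-- The value of a type in the canonical model under the canonical interpretation. -/
def canonicalValue (A : Formula L) : Set Lam :=
  (canonical.{u, v, w} E Γ).value A (fun x => canonicalCls E Γ (.var x)) (canonicalRel E Γ)

theorem canonicalValue_saturated (A : Formula L) :
    Saturated (canonicalValue.{u, v, w} E Γ A) :=
  (canonical.{u, v, w} E Γ).value_saturated A _ _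

theorem mem_canonicalValue_var {n X : ℕ} {ts : Fin n → L.Term ℕ} {t : Lam} :
    t ∈ canonicalValue.{u, v, w} E Γ (.var n X ts) ↔
      ∃ t', BetaRed t t' ∧ NormalIn E Γ t' (.var n X ts) := by
  simp only [canonicalValue, Model.value, canonical_val_var]
  exact mem_atomSet.{u, v, w} (sim_var_congr n X)

theorem mem_canonicalValue_sym {n : ℕ} {P : L.Relations n} {ts : Fin n → L.Term ℕ} {t : Lam} :
    t ∈ canonicalValue.{u, v, w} E Γ (.sym P ts) ↔
      ∃ t', BetaRed t t' ∧ NormalIn E Γ t' (.sym P ts) := by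
  simp only [canonicalValue, Model.value, canonical_val_var]
  exact mem_atomSet.{u, v, w} (sim_sym_congr P)

theorem mem_canonicalValue_all₁ {A : Formula L} {t : Lam} :
    t ∈ canonicalValue.{u, v, w} E Γ (.all₁ A) ↔
      ∀ a, t ∈ canonicalValue.{u, v, w} E Γ (A.inst₁ a) := by
  simp only [canonicalValue, Model.value_inst₁, canonical_val_var, Model.value, Set.mem_iInter]
  refine ⟨fun h a => h _, fun h q => ?_⟩
  obtain ⟨a, rfl⟩ := exists_canonicalCls q
  exact h a

/-- The intersection ranges over all functions into `R`, among them the canonical interpretation of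
`Y`. -/
theorem mem_canonicalValue_inst₂ {n : ℕ} {A : Formula L} {t : Lam}
    (h : t ∈ canonicalValue.{u, v, w} E Γ (.all₂ n A)) (Y : ℕ) :
    t ∈ canonicalValue.{u, v, w} E Γ (A.rren (instRel n Y)) := by
  rw [← Formula.inst₂_genVar, canonicalValue, Model.value_inst₂]
  exact Set.mem_iInter.1 h _

/-! ### Completeness -/

/-- The members of the value of a positive subtype reduce to normal terms of this type, and the
value of a negative subtype contains the neutral terms of this type. -/
theorem canonical_main {nm : List Dir → ℕ → ℕ} {A : Formula L}
    (hnm : Function.Injective (Function.uncurry nm)) (hc : A.Closed) (hA : GoodPos E A)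
    (hΓ : ∀ x D, Γ x = some D → SubtypeSubst nm .neg A D)
    (hinf : ∀ D, SubtypeSubst nm .neg A D → {x | Γ x = some D}.Infinite) (k : ℕ) :
    ∀ S : Formula L, S.size < k →
      (SubtypeSubst nm .pos A S → ∀ t ∈ canonicalValue.{u, v, w} E Γ S,
        ∃ t', BetaRed t t' ∧ NormalIn E Γ t' S) ∧
      (SubtypeSubst nm .neg A S → ∀ t Cs, Neutral E Γ t Cs S →
        t ∈ canonicalValue.{u, v, w} E Γ S) := by
  have hpol : ∀ x D, Γ x = some D → Polar .neg D := fun x D h => (hΓ x D h).polar hA.1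
  induction k with
  | zero => intro S hS; omega
  | succ k ih =>
    intro S hS
    cases S with
    | var n X ts =>
      exact ⟨fun _ t ht => mem_canonicalValue_var.1 ht,
        fun _ t Cs ht => mem_canonicalValue_var.2 ⟨t, .refl, ht.normalIn⟩⟩
    | sym P ts =>
      exact ⟨fun _ t ht => mem_canonicalValue_sym.1 ht,
        fun _ t Cs ht => mem_canonicalValue_sym.2 ⟨t, .refl, ht.normalIn⟩⟩
    | imp B C =>
      simp only [Formula.size] at hS
      have ihB := ih B (by omega)
      have ihC := ih C (by omega)
      constructor
      · intro hpos t ht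
        have hB : SubtypeSubst nm .neg A B := hpos.imp_left
        -- Infinitely many variables are declared with type `B`, so one of them is not free in `t`.
        obtain ⟨y, hyB, hyt⟩ := (hinf B hB).exists_notMem_finite t.finite_hasVar
        have hy : VarHasType E Γ y B := ⟨B, B, hyB, .refl, .refl⟩
        obtain ⟨t', hred, hn⟩ := ihC.1 hpos.imp_right _ (ht _ (ihB.2 hB _ _ (.var hy)))
        rcases hred.app_var with ⟨t₁, rfl, h₁⟩ | ⟨t₀, h₀, h₁⟩
        · refine ⟨t₁, h₁, ?_⟩
          obtain ⟨-, ⟨_, e⟩ | ⟨_, hn⟩⟩ := hn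
          · cases e
          · cases hn with
            | @app _ _ Cs B' _ hne _ hv =>
              obtain ⟨D, G, hD, hG, hs⟩ := hv y rfl
              cases hyB.symm.trans hD
              obtain ⟨x, -, D', G', hD', hG', hs'⟩ := hne.spine
              obtain ⟨Cs', F, rfl, hF⟩ := hs'.of_foldr_imp
              obtain ⟨Cn, D₀, rfl, hCn, -⟩ := hF.of_imp
              -- Here `B ≤ G ∼ B' ∼ Cn`, and the declared type `D'` of the head variable of `t₁`
              -- satisfies `D' ≤ Cs' → Cn → D₀`. Both `B` and `D'` are negative subtypes with
              -- substitution, so (*) forbids `B < G`.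
              have hBG : B = G := by
                by_contra hBG
                exact hA.2 nm ⟨hnm, fun p i => ⟨hc.1 _, fun n => hc.2 n _⟩⟩ B D' hB
                  (hΓ x D' hD') Cs' Cn D₀ G ⟨⟨hG.le, hBG⟩, hs.trans hCn.symm, hG'.le⟩
              cases hBG
              exact (hne.sim (hs.symm.imp_left C)).normalIn
        · have hy₀ : ¬ (Lam.lam t₀).HasVar y := fun h => hyt (h₀.hasVar h)
          exact ⟨_, h₀.trans (h₁.abs hy₀), hn.1.lam hyB, .inl ⟨_, rfl⟩⟩
      · intro hneg t Cs ht s hs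
        obtain ⟨s', hred, hn⟩ := ihB.1 hneg.imp_left s hs
        exact canonicalValue_saturated C _ _
          -- The argument is replaced by its normal reduct. If that is a variable, being neutral
          -- gives the `VarHasType` required by `Neutral.app`.
          (ihC.2 hneg.imp_right _ _ (ht.app hn.1 fun y e => by
            subst e
            exact hn.varHasType)) (hred.appR t)
    | all₁ B =>
      simp only [Formula.size] at hS
      constructor
      · intro hpos
        exact (hpos.polar hA.1).elim
      · intro hneg t Cs ht
        refine mem_canonicalValue_all₁.2 fun a => ?_
        exact (ih _ (by rw [Formula.inst₁, Formula.size_subst]; omega)).2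
          (hneg.inst₁ hnm hc a) t Cs (ht.inst₁ hpol a)
    | all₂ n B =>
      simp only [Formula.size] at hS
      constructor
      · intro hpos t ht
        obtain ⟨f, hf, hfr⟩ := hpos.inst₂ hnm hc
        -- Names to avoid: the relation variables free in the types declared for the free variables
        -- of `t`.
        have hfin : {Y | ∃ x D, t.HasVar x ∧ Γ x = some D ∧ D.HasRel n Y}.Finite := by
          refine (t.finite_hasVar.biUnion (t := fun x => {Y | ∃ D, Γ x = some D ∧ D.HasRel n Y})
            fun x _ => ?_).subset ?_
          · rcases h : Γ x with _ | D
            · simp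
            · obtain ⟨b, hb⟩ := D.exists_rel_bound
              refine (Set.finite_lt_nat b).subset ?_
              rintro Y ⟨D', e, hY⟩
              cases e
              exact hb n Y hY
          · rintro Y ⟨x, D, hx, hD⟩
            exact Set.mem_biUnion (show x ∈ {x | t.HasVar x} from hx) ⟨D, hD⟩
        obtain ⟨_, ⟨i, rfl⟩, hi⟩ :=
          (Set.infinite_range_of_injective hf).exists_notMem_finite hfin
        obtain ⟨hsub, hfree⟩ := hfr i
        obtain ⟨t', hred, hn⟩ := (ih _ (by rw [Formula.size_rren]; omega)).1 hsub t
          (mem_canonicalValue_inst₂ ht (f i))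
        have hD : ∀ x D, t'.HasVar x → Γ x = some D → ¬ D.HasRel n (f i) :=
          fun x D hx hD h => hi ⟨x, D, hred.hasVar hx, hD, h⟩
        refine ⟨t', hred, hn.1.generalize hD hfree, ?_⟩
        rcases hn.2 with h | ⟨Cs, h⟩
        · exact .inl h
        · obtain ⟨x, hx, D, G, hxD, hG, hs⟩ := h.spine
          -- The reduct cannot be neutral: `X` is free in `B` by positivity, so its name would be
          -- free in the type of the head variable, against its choice. Only an abstraction remains.
          refine absurd (hG.hasRel (hs.hasRel.2 ?_)) (hD x D hx hxD)
          have : (B.rren (instRel n (f i))).HasRel n (f i) :=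
            Formula.hasRel_rren.2 ⟨0, (hpos.polar hA.1).2, consRel_self_zero ..⟩
          clear * - this
          induction Cs with
          | nil => exact this
          | cons C Cs ih => exact .inr ih
      · intro hneg
        exact (hneg.polar hA.1).elim

end

end AF2

/-! ### The main theorem -/

theorem mainTheorem4 (L : FirstOrder.Language.{u, v}) (hL : ∀ n : ℕ, Countable (L.Functions n))
    (E : Set (L.Term ℕ × L.Term ℕ)) (A : AF2.Formula L) (hclosed : A.Closed)
    (hA : AF2.GoodPos E A) (t : AF2.Lam) :
    t ∈ AF2.betaValue.{u, v, w} E A ↔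
      ∃ t' : AF2.Lam, AF2.BetaRed t t' ∧ AF2.Typed₀ E [] t' A := by
  constructor
  · intro ht
    -- Makes the countability of the function symbols available to instance search, which yields
    -- `Countable (L.Term ℕ)`.
    have := hL
    obtain ⟨nm, hnm⟩ := AF2.exists_injective_nm
    obtain ⟨k, hk⟩ := t.exists_bound
    obtain ⟨Γ, hΓk, hΓ, hinf⟩ :=
      AF2.exists_enumeration (AF2.countable_subtypeSubst (nm := nm) .neg A) k
    obtain ⟨t', hred, hn⟩ := (AF2.canonical_main.{u, v, w} hnm hclosed hA hΓ hinf _ A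
      (Nat.lt_succ_self _)).1
      ⟨A, FirstOrder.Language.Term.var, .self _ _, A.subst_var.symm⟩ t
      (ht _ AF2.canonical_satisfies _ _)
    refine ⟨t', hred, hn.1.2 [] fun x hx => ?_⟩
    -- `Γ` is undefined below `k`, where all free variables of `t`, hence of its reduct `t'`, lie;
    -- the empty context therefore agrees with `Γ` on them.
    rw [hΓk x (hk x (hred.hasVar hx))]
    rfl
  · rintro ⟨t', hred, ht'⟩ M hM I J
    have := ht'.sound hM I J AF2.Lam.var (by simp)
    rw [AF2.Lam.subst_var] at this
    exact M.value_saturated A I J _ _ this hred
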